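/- A marriage instance is a finite bipartite graph $G=(A\cup B,E)$ in which every vertex ranks its neighbors in a strict preference order; let $m=|E|$, let $\mathcal M_G$ be the set of matchings of $G$, and for $u\in A\cup B$ let $\delta(u)$ be the set of edges incident to $u$. For matchings $M,N$ let $\phi(M,N)$ be the number of vertices that prefer their assignment in $M$ to the one in $N$ (being unmatched is the worst option). A matching $M$ is popular if $\phi(M,N)\ge\phi(N,M)$ for all matchings $N$; a popular matching $M$ is dominant if $\phi(M,N)>\phi(N,M)$ for every matching $N$ with $|N|>|M|$. The dominant matching polytope $\mathcal D_G\subset\mathbb R^m$ is the convex hull of the incidence vectors of the dominant matchings of $G$. Let $E_D$ be the set of edges that lie in some dominant matching, and let $U$ be the set of vertices that are matched in no maximum-size popular matching. For a matching $M$ let $k_M$ be the number of vertices of $U$ that are matched in $M$, and for $x\in\mathbb R^m$ let $\mathrm{wt}_x(M)=\sum_{u\in A\cup B}\mathrm{vote}_u(M,x)$, where - for $u\in U$: $\mathrm{vote}_u(M,x)=1$ if $u$ is matched in $M$, and $0$ otherwise; - for $u\notin U$: $\mathrm{vote}_u(M,x)=\sum_{v'\prec_u v}x_{(u,v')}-\sum_{v'\succ_u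 v}x_{(u,v')}$ if $u$ is matched to $v$ in $M$, where $v'$ ranges over the neighbors of $u$ that are worse, respectively better, for $u$ than $v$; and $-1$ if $u$ is unmatched in $M$. Theorem. (1) For every marriage instance $G$, $\mathcal D_G$ is the set of all $x\in\mathbb R^m$ that satisfy the constraints $$\sum_{e\in\delta(u)}x_e=1\ \ (u\in(A\cup B)\setminus U),\qquad x_e=0\ \ (e\in E\setminus E_D),\qquad x_e\ge 0\ \ (e\in E_D),\qquad \mathrm{wt}_x(M)\le -k_M\ \ (M\in\mathcal M_G).$$ Each of these is a linear constraint in $x$, and their number is $O(|\mathcal M_G|)$, with an absolute constant. (2) There are constants $c>1$ and $\delta>0$ and marriage instances $G$ with arbitrarily many edges such that $\mathcal D_G$ has at least $\delta c^m$ facets, where $m$ is the number of edges of $G$. -/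

import Mathlib

/-- A marriage instance: a bipartite graph with sides `A`, `B` and edge set `edges`, where every
vertex ranks its neighbours in a strict order (a smaller rank is a better neighbour; only the
ranks of neighbours are ever relevant). -/
structure MarriageInstance (A : Type*) (B : Type*) where
  edges : Finset (A × B)
  rankA : A → B → ℕ
  rankB : B → A → ℕ
  rankA_strict : ∀ a b b', (a, b) ∈ edges → (a, b') ∈ edges → rankA a b = rankA a b' → b = b'
  rankB_strict : ∀ b a a', (a, b) ∈ edges → (a', b) ∈ edges → rankB b a = rankB b a' → a = a'

namespace MarriageInstance

section
variable {A B : Type*}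

/-! ### Matchings -/

/-- `M` is a set of edges of `G`, no two of which share an endpoint. -/
def IsMatching (G : MarriageInstance A B) (M : Finset (A × B)) : Prop :=
  M ⊆ G.edges ∧ (∀ e ∈ M, ∀ f ∈ M, e.1 = f.1 → e = f) ∧ (∀ e ∈ M, ∀ f ∈ M, e.2 = f.2 → e = f)

open Classical in
/-- The set of all matchings of `G` (including the empty one). -/
noncomputable def matchings (G : MarriageInstance A B) : Finset (Finset (A × B)) :=
  G.edges.powerset.filter G.IsMatching

/-- `a` is matched by `M`. -/
def MatchedA (M : Finset (A × B)) (a : A) : Prop := ∃ b, (a, b) ∈ M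

/-- `b` is matched by `M`. -/
def MatchedB (M : Finset (A × B)) (b : B) : Prop := ∃ a, (a, b) ∈ M

/-! ### Popular and dominant matchings -/

/-- `a` votes for `M` against `N`: `a` is matched in `M`, and in `N` it is either unmatched or
matched to a worse partner. -/
def PrefersA (G : MarriageInstance A B) (a : A) (M N : Finset (A × B)) : Prop :=
  ∃ b, (a, b) ∈ M ∧ ∀ b', (a, b') ∈ N → G.rankA a b < G.rankA a b'

/-- `b` votes for `M` against `N`. -/
def PrefersB (G : MarriageInstance A B) (b : B) (M N : Finset (A × B)) : Prop :=
  ∃ a, (a, b) ∈ M ∧ ∀ a', (a', b) ∈ N → G.rankB b a < G.rankB b a'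

open Classical in
/-- `φ(M, N)`: the number of vertices that vote for `M` against `N`. -/
noncomputable def votes [Fintype A] [Fintype B] (G : MarriageInstance A B)
    (M N : Finset (A × B)) : ℕ :=
  (Finset.univ.filter fun a : A => G.PrefersA a M N).card +
    (Finset.univ.filter fun b : B => G.PrefersB b M N).card

/-- `M` is a popular matching: no matching is more popular than `M`. -/
def IsPopular [Fintype A] [Fintype B] (G : MarriageInstance A B) (M : Finset (A × B)) : Prop :=
  G.IsMatching M ∧ ∀ N, G.IsMatching N → G.votes N M ≤ G.votes M N

/-- `M` is a popular matching that is more popular than every strictly larger matching. -/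
def IsDominant [Fintype A] [Fintype B] (G : MarriageInstance A B) (M : Finset (A × B)) : Prop :=
  G.IsPopular M ∧ ∀ N, G.IsMatching N → M.card < N.card → G.votes N M < G.votes M N

/-- `M` is a popular matching of maximum size among the popular matchings. -/
def IsMaxPopular [Fintype A] [Fintype B] (G : MarriageInstance A B) (M : Finset (A × B)) : Prop :=
  G.IsPopular M ∧ ∀ N, G.IsPopular N → N.card ≤ M.card

/-- `a` is an unpopular vertex: no maximum-size popular matching matches it. -/
def UnpopularA [Fintype A] [Fintype B] (G : MarriageInstance A B) (a : A) : Prop :=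
  ∀ M, G.IsMaxPopular M → ¬ MatchedA M a

/-- `b` is an unpopular vertex: no maximum-size popular matching matches it. -/
def UnpopularB [Fintype A] [Fintype B] (G : MarriageInstance A B) (b : B) : Prop :=
  ∀ M, G.IsMaxPopular M → ¬ MatchedB M b

/-- `e` is a dominant edge: some dominant matching contains it. -/
def IsDominantEdge [Fintype A] [Fintype B] (G : MarriageInstance A B) (e : A × B) : Prop :=
  ∃ M, G.IsDominant M ∧ e ∈ M

/-! ### The dominant matching polytope -/

open Classical in
/-- The incidence vector of `M` in `ℝ^E`. -/
noncomputable def incidence (G : MarriageInstance A B) (M : Finset (A × B)) : G.edges → ℝ :=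
  fun e => if (e : A × B) ∈ M then 1 else 0

/-- The convex hull of the incidence vectors of the dominant matchings. -/
def dominantPolytope [Fintype A] [Fintype B] (G : MarriageInstance A B) : Set (G.edges → ℝ) :=
  convexHull ℝ {x | ∃ M, G.IsDominant M ∧ x = G.incidence M}

/-! ### The linear constraints -/

open Classical in
/-- The sum of `x_e` over the edges `e` incident to `a`. -/
noncomputable def degreeA (G : MarriageInstance A B) (x : G.edges → ℝ) (a : A) : ℝ :=
  ∑ e : G.edges, if e.1.1 = a then x e else 0

open Classical in
/-- The sum of `x_e` over the edges `e` incident to `b`. -/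
noncomputable def degreeB (G : MarriageInstance A B) (x : G.edges → ℝ) (b : B) : ℝ :=
  ∑ e : G.edges, if e.1.2 = b then x e else 0

open Classical in
/-- The vote of `a` for its neighbour `b` against `x`: the `x`-weight of the neighbours that are
worse than `b` minus the `x`-weight of those that are better than `b`. -/
noncomputable def voteA (G : MarriageInstance A B) (x : G.edges → ℝ) (a : A) (b : B) : ℝ :=
  (∑ e : G.edges, if e.1.1 = a ∧ G.rankA a b < G.rankA a e.1.2 then x e else 0) -
    ∑ e : G.edges, if e.1.1 = a ∧ G.rankA a e.1.2 < G.rankA a b then x e else 0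

open Classical in
/-- The vote of `b` for its neighbour `a` against `x`. -/
noncomputable def voteB (G : MarriageInstance A B) (x : G.edges → ℝ) (b : B) (a : A) : ℝ :=
  (∑ e : G.edges, if e.1.2 = b ∧ G.rankB b a < G.rankB b e.1.1 then x e else 0) -
    ∑ e : G.edges, if e.1.2 = b ∧ G.rankB b e.1.1 < G.rankB b a then x e else 0

open Classical in
/-- The vote of `a` for its assignment in `M` against its assignment in `x`. -/
noncomputable def matchVoteA [Fintype A] [Fintype B] (G : MarriageInstance A B)
    (x : G.edges → ℝ) (M : Finset (A × B)) (a : A) : ℝ :=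
  if G.UnpopularA a then (if MatchedA M a then 1 else 0)
  else if h : MatchedA M a then G.voteA x a h.choose else -1

open Classical in
/-- The vote of `b` for its assignment in `M` against its assignment in `x`. -/
noncomputable def matchVoteB [Fintype A] [Fintype B] (G : MarriageInstance A B)
    (x : G.edges → ℝ) (M : Finset (A × B)) (b : B) : ℝ :=
  if G.UnpopularB b then (if MatchedB M b then 1 else 0)
  else if h : MatchedB M b then G.voteB x b h.choose else -1

/-- `wt_x(M)`: the sum over all vertices of their votes for `M` against `x`. -/
noncomputable def wt [Fintype A] [Fintype B] (G : MarriageInstance A B)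
    (x : G.edges → ℝ) (M : Finset (A × B)) : ℝ :=
  (∑ a : A, G.matchVoteA x M a) + ∑ b : B, G.matchVoteB x M b

open Classical in
/-- `k_M`: the number of unpopular vertices that are matched in `M`. -/
noncomputable def numUnpopularMatched [Fintype A] [Fintype B] (G : MarriageInstance A B)
    (M : Finset (A × B)) : ℕ :=
  (Finset.univ.filter fun a : A => G.UnpopularA a ∧ MatchedA M a).card +
    (Finset.univ.filter fun b : B => G.UnpopularB b ∧ MatchedB M b).card

/-- The index set of the constraints: one degree equality for every vertex that is not unpopular,
one equality for every non-dominant edge, one sign constraint for every dominant edge, and one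
inequality for every matching. -/
inductive ConstraintIndex [Fintype A] [Fintype B] (G : MarriageInstance A B) where
  | vertexA (a : A) (h : ¬ G.UnpopularA a)
  | vertexB (b : B) (h : ¬ G.UnpopularB b)
  | zero (e : G.edges) (h : ¬ G.IsDominantEdge e)
  | nonneg (e : G.edges) (h : G.IsDominantEdge e)
  | matching (M : Finset (A × B)) (h : G.IsMatching M)

/-- The set of the points of `ℝ^E` that satisfy the given constraint. -/
def constraint [Fintype A] [Fintype B] (G : MarriageInstance A B) :
    G.ConstraintIndex → Set (G.edges → ℝ)
  | .vertexA a _ => {x | G.degreeA x a = 1}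
  | .vertexB b _ => {x | G.degreeB x b = 1}
  | .zero e _ => {x | x e = 0}
  | .nonneg e _ => {x | 0 ≤ x e}
  | .matching M _ => {x | G.wt x M ≤ -(G.numUnpopularMatched M : ℝ)}

end

end MarriageInstance

/-- The set `H` of points of `ℝ^ι` is cut out by one linear inequality or one linear equation. -/
def IsLinearConstraint {ι : Type*} [Fintype ι] (H : Set (ι → ℝ)) : Prop :=
  ∃ (p : ι → ℝ) (q : ℝ), H = {x | ∑ i, p i * x i ≤ q} ∨ H = {x | ∑ i, p i * x i = q}

/-- `F` is a facet of the polytope `P`: a nonempty face whose dimension is one less than the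
dimension of `P` (which need not be full-dimensional). -/
def IsFacet {ι : Type*} [Fintype ι] (P F : Set (ι → ℝ)) : Prop :=
  F.Nonempty ∧ IsExposed ℝ P F ∧
    Module.finrank ℝ (vectorSpan ℝ F) + 1 = Module.finrank ℝ (vectorSpan ℝ P)

/-- The number of facets of the polytope `P`. -/
noncomputable def numFacets {ι : Type*} [Fintype ι] (P : Set (ι → ℝ)) : ℕ :=
  Set.ncard {F | IsFacet P F}

/-! ### Linear programming duality for bipartite matchings -/

section
open Classical Finset

/-! Part (1), validity. If M is dominant and N is any matching, popularity of M sharpens to φ(N, M)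
+ k ≤ φ(M, N), where k counts the vertices matched by N but not by M
(`IsDominant.votes_add_numNewlyMatched_le`). Indeed, on a path or cycle of the symmetric difference
the sum of the votes has the parity of the number of its newly matched vertices. A path with two of
them allows M to be enlarged, so the sum there is negative and even, hence at most -2. Consequently
every dominant matching leaves exactly U unmatched, and the matching constraints at its incidence
vector are precisely the sharpened inequalities.

Part (1), sufficiency. For feasible x the matching constraints bound a maximum-weight matching
problem by 0. Duality (`exists_dual_of_matching_weights`) yields potentials α, β, and since x has
weight 0 against itself, complementary slackness makes them tight on the support of x. Lay the
neighbours of each a outside U along a unit interval from best to worst, those of each b outside U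
from worst to best, giving each edge a cell of length x_e. The weight of an edge outside U is then
twice the difference of its two cell starts. Translating the intervals by α/2 and -β/2 therefore
makes the two cells of each support edge coincide. Wrap the intervals around a circle of length 1: a
point θ picks one cell at each vertex outside U, that is, a matching, and potentials ±1, recording
which intervals are read past the wrap, certify it as dominant (`IsFeasible.isDominant_roundAt`).
For uniform θ the edge e is picked with probability x_e, so x is an average of dominant matchings.
No separate existence theorem for dominant matchings is needed.

Part (2). In a chain of n pairs of 4-cycles, the dominant matchings choose in each cycle between two
perfect matchings, straight or crossing, under the sole restriction that at most one pair is an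
ascent (lower cycle straight, upper cycle crossing). For each set S of at least two pairs, "crossing
upper cycles minus crossing lower cycles over S is at most 1" defines a facet, and different S give
different facets, while the number of edges is linear in n. -/

/-- Assignment duality: a bound on the weights of all permutations is certified by potentials. -/
theorem exists_assignment_potential {I : Type*} [Fintype I] (W : I → I → ℝ) (c : ℝ)
    (hW : ∀ i j, 0 ≤ W i j) (h : ∀ σ : Equiv.Perm I, ∑ i, W i (σ i) ≤ c) :
    ∃ u v : I → ℝ, (∀ i, 0 ≤ u i) ∧ (∀ j, 0 ≤ v j) ∧ (∀ i j, W i j ≤ u i + v j) ∧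
      ∑ i, u i + ∑ j, v j ≤ c := by
  rcases isEmpty_or_nonempty I with hI | hI
  · exact ⟨0, 0, fun i => hI.elim i, fun i => hI.elim i, fun i => hI.elim i, by simpa using h 1⟩
  set K : ℝ := ∑ i, ∑ j, W i j with hK
  have hWK : ∀ i j, W i j ≤ K := fun i j =>
    (single_le_sum (f := fun j => W i j) (fun j _ => hW i j) (mem_univ j)).trans
      (single_le_sum (f := fun i => ∑ j, W i j) (fun i _ => sum_nonneg fun j _ => hW i j)
        (mem_univ i))
  have hK0 : 0 ≤ K := (hW hI.some hI.some).trans (hWK _ _)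
  let s : Set ((I → ℝ) × (I → ℝ)) :=
    Set.Icc (0, 0) (fun _ => K, fun _ => K) ∩ {p | ∀ i j, W i j ≤ p.1 i + p.2 j}
  have hs : IsCompact s := by
    refine isCompact_Icc.inter_right ?_
    simp only [Set.ofPred_forall]
    refine isClosed_iInter fun i => isClosed_iInter fun j => isClosed_le (by fun_prop) (by fun_prop)
  have hne : s.Nonempty := by
    refine ⟨(fun _ => K, 0), ⟨⟨⟨fun _ => hK0, fun _ => le_rfl⟩, ⟨fun _ => le_rfl, fun _ => hK0⟩⟩, ?_⟩⟩
    intro i j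
    simpa using hWK i j
  obtain ⟨⟨u, v⟩, ⟨⟨⟨hu0, hv0⟩, -⟩, huv⟩, hmin⟩ := hs.exists_isMinOn hne
    (f := fun p => ∑ i, p.1 i + ∑ j, p.2 j) (by fun_prop)
  -- Minimality in the box extends to all potentials, of any sign. Moving a constant from `v'` to
  -- `u'` preserves the total, because both sides are indexed by `I`, and makes both nonnegative.
  -- Truncation at `K`, which bounds every weight, keeps the covering condition and does not raise
  -- the total.
  have hglob : ∀ u' v' : I → ℝ, (∀ i j, W i j ≤ u' i + v' j) →
      ∑ i, u i + ∑ j, v j ≤ ∑ i, u' i + ∑ j, v' j := by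
    intro u' v' hf
    obtain ⟨j₀, -, hj₀⟩ := exists_min_image univ v' univ_nonempty
    have hu'' : ∀ i, 0 ≤ u' i + v' j₀ := fun i => (hW i j₀).trans (hf i j₀)
    have hv'' : ∀ j, 0 ≤ v' j - v' j₀ := fun j => sub_nonneg.2 (hj₀ j (mem_univ j))
    have hmem : ((fun i => min (u' i + v' j₀) K, fun j => min (v' j - v' j₀) K) :
        (I → ℝ) × (I → ℝ)) ∈ s := by
      refine ⟨⟨⟨fun i => le_min (hu'' i) hK0, fun j => le_min (hv'' j) hK0⟩,
        ⟨fun i => min_le_right _ _, fun j => min_le_right _ _⟩⟩, fun i j => ?_⟩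
      have := hf i j
      have := hWK i j
      have := hu'' i
      have := hv'' j
      simp only
      rcases min_choice (u' i + v' j₀) K with h1 | h1 <;>
        rcases min_choice (v' j - v' j₀) K with h2 | h2 <;> rw [h1, h2] <;> linarith
    have h1 := hmin hmem
    simp only [Set.mem_ofPred_eq] at h1
    refine h1.trans ?_
    have h2 : ∑ i, min (u' i + v' j₀) K ≤ ∑ i, (u' i + v' j₀) :=
      sum_le_sum fun i _ => min_le_left _ _
    have h3 : ∑ j, min (v' j - v' j₀) K ≤ ∑ j, (v' j - v' j₀) :=
      sum_le_sum fun i _ => min_le_left _ _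
    rw [sum_add_distrib] at h2
    rw [sum_sub_distrib] at h3
    linarith
  refine ⟨u, v, hu0, hv0, huv, ?_⟩
  let T : I → Finset I := fun i => univ.filter fun j => W i j = u i + v j
  by_cases hall : ∀ S : Finset I, S.card ≤ (S.biUnion T).card
  · obtain ⟨f, hf, hfT⟩ := (all_card_le_biUnion_card_iff_exists_injective T).1 hall
    have hbij := Finite.injective_iff_bijective.1 hf
    have h1 := h (Equiv.ofBijective f hbij)
    have h2 : ∀ i, W i (f i) = u i + v (f i) := fun i => (mem_filter.1 (hfT i)).2
    have h3 : ∑ i, v (f i) = ∑ j, v j := hbij.sum_comp v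
    simp only [Equiv.ofBijective_apply, h2, sum_add_distrib] at h1
    linarith
  · exfalso
    push Not at hall
    obtain ⟨S, hS⟩ := hall
    obtain ⟨ε, hε0, hε⟩ : ∃ ε : ℝ, 0 < ε ∧ ∀ i j, j ∉ T i → W i j + ε ≤ u i + v j := by
      have : ∀ᶠ ε : ℝ in nhdsWithin 0 (Set.Ioi 0),
          ∀ i j, j ∉ T i → W i j + ε ≤ u i + v j := by
        refine Filter.eventually_all.2 fun i => Filter.eventually_all.2 fun j => ?_
        by_cases hj : j ∈ T i
        · simp [hj]
        · have : W i j < u i + v j := lt_of_le_of_ne (huv i j) fun he => hj (by simp [T, he])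
          have h1 : ∀ᶠ ε : ℝ in nhds 0, ε < u i + v j - W i j :=
            eventually_lt_nhds (by linarith)
          filter_upwards [nhdsWithin_le_nhds h1] with ε hε _
          linarith
      obtain ⟨ε, h1, h2⟩ := (this.and self_mem_nhdsWithin).exists
      exact ⟨ε, h2, h1⟩
    -- A violator `S` of Hall's condition in the graph of tight pairs contradicts minimality:
    -- lowering `u` on `S` and raising `v` on its tight neighbours by `ε` keeps the covering
    -- condition and lowers the total, since the neighbours are fewer.
    have h1 := hglob (fun i => u i - if i ∈ S then ε else 0)
      (fun j => v j + if j ∈ S.biUnion T then ε else 0) (by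
        intro i j
        have h2 := huv i j
        by_cases hi : i ∈ S
        · by_cases hj : j ∈ T i
          · have : j ∈ S.biUnion T := mem_biUnion.2 ⟨i, hi, hj⟩
            simp only [hi, this, if_true]
            linarith
          · have := hε i j hj
            simp only [hi, if_true]
            split_ifs <;> linarith
        · simp only [hi, if_false]
          split_ifs <;> linarith)
    simp only [sum_sub_distrib, sum_add_distrib, sum_ite_mem, univ_inter, sum_const,
      nsmul_eq_mul] at h1
    have h2 : ((S.biUnion T).card : ℝ) < S.card := by exact_mod_cast hS
    nlinarith

/-- A sum over all vertices of one side, split into the endpoints of a matching and the rest. -/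
theorem sum_eq_sum_proj_add {T A R : Type*} [Fintype A] [AddCommMonoid R] (N : Finset T)
    (π : T → A) (hπ : ∀ e ∈ N, ∀ f ∈ N, π e = π f → e = f) (h : A → R) :
    ∑ a, h a = ∑ e ∈ N, h (π e) + ∑ a, if ∃ e ∈ N, π e = a then 0 else h a := by
  have h1 : ∑ e ∈ N, h (π e) = ∑ a, if ∃ e ∈ N, π e = a then h a else 0 := by
    rw [← sum_image (f := h) (g := π) fun e he f hf => hπ e he f hf, ← sum_filter]
    refine sum_congr ?_ fun _ _ => rfl
    ext a
    simp
  rw [h1, ← sum_add_distrib]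
  refine sum_congr rfl fun a _ => ?_
  split_ifs <;> simp

open MarriageInstance in
theorem sum_eq_sum_fst_add {A B R : Type*} [Fintype A] [AddCommMonoid R] (N : Finset (A × B))
    (hN : ∀ e ∈ N, ∀ f ∈ N, e.1 = f.1 → e = f) (h : A → R) :
    ∑ a, h a = ∑ e ∈ N, h e.1 + ∑ a, if MatchedA N a then 0 else h a := by
  rw [sum_eq_sum_proj_add N Prod.fst hN h]
  congr! 4 with a
  simp [MatchedA]

open MarriageInstance in
theorem sum_eq_sum_snd_add {A B R : Type*} [Fintype B] [AddCommMonoid R] (N : Finset (A × B))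
    (hN : ∀ e ∈ N, ∀ f ∈ N, e.2 = f.2 → e = f) (h : B → R) :
    ∑ b, h b = ∑ e ∈ N, h e.2 + ∑ b, if MatchedB N b then 0 else h b := by
  rw [sum_eq_sum_proj_add N Prod.snd hN h]
  congr! 4 with b
  simp [MatchedB]

open MarriageInstance in
/-- Duality for weighted bipartite matchings with weights for unmatched vertices. -/
theorem exists_dual_of_matching_weights {A B : Type*} [Fintype A] [Fintype B]
    (E : Finset (A × B)) (w : A → B → ℝ) (lA : A → ℝ) (lB : B → ℝ)
    (h : ∀ N ⊆ E, (∀ e ∈ N, ∀ f ∈ N, e.1 = f.1 → e = f) →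
      (∀ e ∈ N, ∀ f ∈ N, e.2 = f.2 → e = f) →
      ∑ e ∈ N, w e.1 e.2 + (∑ a, if MatchedA N a then 0 else lA a) +
        (∑ b, if MatchedB N b then 0 else lB b) ≤ 0) :
    ∃ (α : A → ℝ) (β : B → ℝ), (∀ a b, (a, b) ∈ E → w a b ≤ α a + β b) ∧ (∀ a, lA a ≤ α a) ∧
      (∀ b, lB b ≤ β b) ∧ ∑ a, α a + ∑ b, β b ≤ 0 := by
  -- The gain of using an edge over leaving both endpoints unmatched. With gains truncated at zero,
  -- permutations of `A ⊕ B` stand for matchings: a vertex not sent along an edge of positive gain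
  -- counts as unmatched.
  let w' : A → B → ℝ := fun a b => w a b - lA a - lB b
  let W : A ⊕ B → A ⊕ B → ℝ := fun i j =>
    match i, j with
    | .inl a, .inr b => if (a, b) ∈ E ∧ 0 < w' a b then w' a b else 0
    | _, _ => 0
  have hW : ∀ i j, 0 ≤ W i j := by
    rintro (a | b) (a' | b') <;> simp only [W, le_refl]
    split_ifs with h1
    · exact h1.2.le
    · exact le_rfl
  obtain ⟨u, v, hu, hv, huv, hsum⟩ := exists_assignment_potential W
    (-(∑ a, lA a + ∑ b, lB b)) hW (by
      intro σ
      let N : Finset (A × B) :=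
        univ.filter fun e => σ (.inl e.1) = .inr e.2 ∧ e ∈ E ∧ 0 < w' e.1 e.2
      have hN1 : ∀ e ∈ N, ∀ f ∈ N, e.1 = f.1 → e = f := by
        intro e he f hf hef
        have h1 := (mem_filter.1 he).2.1
        rw [hef, (mem_filter.1 hf).2.1] at h1
        exact Prod.ext hef (Sum.inr_injective h1).symm
      have hN2 : ∀ e ∈ N, ∀ f ∈ N, e.2 = f.2 → e = f := by
        intro e he f hf hef
        have h1 := (mem_filter.1 he).2.1
        rw [hef, ← (mem_filter.1 hf).2.1] at h1
        exact Prod.ext (Sum.inl_injective (σ.injective h1)) hef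
      have h1 := h N (fun e he => (mem_filter.1 he).2.2.1) hN1 hN2
      have h2 : ∑ i, W i (σ i) = ∑ e ∈ N, w' e.1 e.2 := by
        rw [Fintype.sum_sum_type, sum_filter, Fintype.sum_prod_type]
        have h3 : ∑ b : B, W (.inr b) (σ (.inr b)) = 0 := sum_eq_zero fun b _ => rfl
        rw [h3, add_zero]
        refine sum_congr rfl fun a _ => ?_
        rcases hσ : σ (.inl a) with a' | b
        · simp [W, hσ]
        · rw [sum_eq_single b]
          · simp [W, hσ]
          · intro b' _ hb'
            have : b ≠ b' := hb'.symm
            simp [hσ, this]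
          · simp
      rw [h2, sum_eq_sum_fst_add N hN1 lA, sum_eq_sum_snd_add N hN2 lB]
      simp only [w', sum_sub_distrib]
      linarith)
  rw [Fintype.sum_sum_type, Fintype.sum_sum_type] at hsum
  have h1 : 0 ≤ ∑ b : B, u (.inr b) := sum_nonneg fun b _ => hu _
  have h2 : 0 ≤ ∑ a : A, v (.inl a) := sum_nonneg fun b _ => hv _
  refine ⟨fun a => u (.inl a) + lA a, fun b => v (.inr b) + lB b, ?_, ?_, ?_, ?_⟩
  · intro a b hab
    have h3 := huv (.inl a) (.inr b)
    have h4 := hu (.inl a)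
    have h5 := hv (.inr b)
    simp only [W, hab, true_and] at h3
    split_ifs at h3 with h6
    · simp only [w'] at h3
      linarith
    · simp only [w'] at h6
      linarith
  · intro a
    linarith [hu (.inl a)]
  · intro b
    linarith [hv (.inr b)]
  · rw [sum_add_distrib, sum_add_distrib]
    linarith

end

/-! ### Two involutions and the parity of votes -/

section
open Classical Finset

/-- Let `m`, `n` be involutions and let `vt` be odd where they differ. If `vt` has nonpositive sum
over every invariant set, negative if the set has fixed points of `m` but none of `n`, then the sum
over an invariant set is at most minus the number of fixed points of `m` that `n` moves. -/
theorem sum_add_card_fixed_le_zero {V : Type*} [Fintype V] (m n : V → V)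
    (hm : Function.Involutive m) (hn : Function.Involutive n) (vt : V → ℤ)
    (hodd : ∀ u, m u ≠ n u → Odd (vt u))
    (h1 : ∀ S : Finset V, (∀ u ∈ S, m u ∈ S) → (∀ u ∈ S, n u ∈ S) → ∑ u ∈ S, vt u ≤ 0)
    (h2 : ∀ S : Finset V, (∀ u ∈ S, m u ∈ S) → (∀ u ∈ S, n u ∈ S) →
      (∀ u ∈ S, n u ≠ u) → (∃ u ∈ S, m u = u) → ∑ u ∈ S, vt u < 0)
    (S : Finset V) (hSm : ∀ u ∈ S, m u ∈ S) (hSn : ∀ u ∈ S, n u ∈ S) :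
    ∑ u ∈ S, vt u + (#{u ∈ S | m u = u ∧ n u ≠ u} : ℤ) ≤ 0 := by
  induction S using Finset.strongInduction with
  | H S ih =>
  -- Both terms are additive over a splitting into invariant sets, so only a set without smaller
  -- invariant parts, a component of the symmetric difference, needs an argument.
  by_cases hmin : ∃ T ⊂ S, T.Nonempty ∧ (∀ u ∈ T, m u ∈ T) ∧ (∀ u ∈ T, n u ∈ T)
  · obtain ⟨T, hT, hTne, hTm, hTn⟩ := hmin
    have e1 := ih T hT hTm hTn
    have e2 := ih (S \ T) (sdiff_ssubset hT.1 hTne)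
      (fun u hu => by
        rw [mem_sdiff] at hu ⊢
        exact ⟨hSm u hu.1, fun h => hu.2 (by simpa [hm u] using hTm _ h)⟩)
      (fun u hu => by
        rw [mem_sdiff] at hu ⊢
        exact ⟨hSn u hu.1, fun h => hu.2 (by simpa [hn u] using hTn _ h)⟩)
    have e3 := sum_sdiff (f := vt) hT.1
    have e4 : #{u ∈ S | m u = u ∧ n u ≠ u} =
        #{u ∈ S \ T | m u = u ∧ n u ≠ u} + #{u ∈ T | m u = u ∧ n u ≠ u} := by
      rw [← card_union_of_disjoint, ← filter_union, sdiff_union_of_subset hT.1]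
      exact disjoint_filter_filter sdiff_disjoint
    rw [e4]
    push_cast
    linarith
  push Not at hmin
  have hclosed : ∀ T ⊆ S, T.Nonempty → (∀ u ∈ T, m u ∈ T) → (∀ u ∈ T, n u ∈ T) → T = S := by
    intro T hT hne hTm hTn
    by_contra hne'
    obtain ⟨u, hu, hu'⟩ := hmin T (hT.ssubset_of_ne hne') hne hTm
    exact hu' (hTn u hu)
  by_cases hk : {u ∈ S | m u = u ∧ n u ≠ u} = ∅
  · rw [hk]
    simpa using h1 S hSm hSn
  obtain ⟨u, hu⟩ := nonempty_iff_ne_empty.2 hk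
  obtain ⟨huS, hmu, hnu⟩ := mem_filter.1 hu
  -- A point where `m` and `n` agree spans the invariant set `{v, m v}`. By minimality this would be
  -- all of `S`, and `n` would fix `u`.
  have hmn : ∀ v ∈ S, m v ≠ n v := by
    intro v hv he
    have hT := hclosed {v, m v} (by
      intro w hw
      rcases mem_insert.1 hw with rfl | hw
      · exact hv
      · rw [mem_singleton.1 hw]
        exact hSm v hv) (insert_nonempty _ _)
      (by
        intro w hw
        rcases mem_insert.1 hw with rfl | hw
        · simp
        · rw [mem_singleton.1 hw, hm v]
          simp)
      (by
        intro w hw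
        rcases mem_insert.1 hw with rfl | hw
        · simp [he]
        · rw [mem_singleton.1 hw, he, hn v]
          simp)
    rw [← hT] at huS
    rcases mem_insert.1 huS with rfl | hw
    · exact hnu (he ▸ hmu)
    · have hw := mem_singleton.1 hw
      have : u = v := by rw [← hm v, ← hw, hmu]
      subst this
      exact hnu (he ▸ hmu)
  have hfix : {u ∈ S | m u = u ∧ n u ≠ u} = {u ∈ S | m u = u} := by
    refine filter_congr fun v hv => ⟨fun h => h.1, fun h => ⟨h, fun h' => hmn v hv ?_⟩⟩
    rw [h, h']
  rw [hfix] at hu ⊢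
  -- Every vote in `S` is odd, so the sum has the parity of the size of `S`, and `m` pairs off the
  -- points that it moves. With one fixed point of `m` the sum is odd and nonpositive, hence at most
  -- -1; with two it is even, and strict negativity will give -2.
  have hpar : (∑ v ∈ S, vt v) % 2 = (#{v ∈ S | m v = v} : ℤ) % 2 := by
    have e1 : ((∑ v ∈ S, vt v : ℤ) : ZMod 2) = ((#S : ℤ) : ZMod 2) := by
      push_cast
      rw [card_eq_sum_ones]
      push_cast
      refine sum_congr rfl fun v hv => ?_
      obtain ⟨k, hk⟩ := hodd v (hmn v hv)
      rw [hk]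
      push_cast
      have : (2 : ZMod 2) = 0 := rfl
      rw [this]
      ring
    have e2 : ∑ v ∈ S with ¬ m v = v, (1 : ZMod 2) = 0 := by
      refine sum_involution (fun v _ => m v) (fun _ _ => rfl) (fun v hv _ => (mem_filter.1 hv).2)
        (fun v hv => ?_) (fun v _ => hm v)
      have := mem_filter.1 hv
      exact mem_filter.2 ⟨hSm v this.1, fun h => this.2 (hm.injective h)⟩
    have e3 : ((#S : ℤ) : ZMod 2) = ((#{v ∈ S | m v = v} : ℤ) : ZMod 2) := by
      rw [← card_filter_add_card_filter_not (s := S) (fun v => m v = v)]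
      rw [sum_const, nsmul_eq_mul, mul_one] at e2
      push_cast
      rw [e2, add_zero]
    exact (ZMod.intCast_eq_intCast_iff _ _ 2).1 (e1.trans e3)
  have hle := h1 S hSm hSn
  by_cases hk1 : #{v ∈ S | m v = v} ≤ 1
  · have : #{v ∈ S | m v = v} = 1 := le_antisymm hk1 (card_pos.2 ⟨u, hu⟩)
    rw [this] at hpar ⊢
    push_cast at hpar ⊢
    omega
  -- The walk along the alternating path that starts at `u`. Since `m` conjugates `f` to its inverse
  -- and fixes `u`, it acts on the orbit as the reflection `i ↦ -i` modulo the period `p`, and `n`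
  -- acts as a reflection `i ↦ 1 - i`. So `m` has at most the fixed points `0` and `p / 2`, while a
  -- fixed point of `n` forces `p` to be odd and leaves only one for `m`.
  let f : V → V := fun v => n (m v)
  have hf : Function.Injective f := hn.injective.comp hm.injective
  set p := Function.minimalPeriod f u with hp
  have hp0 : 0 < p :=
    Function.minimalPeriod_pos_of_mem_periodicPts (hf.mem_periodicPts u)
  have hperiod : f^[p] u = u := Function.iterate_minimalPeriod
  have hrefl : ∀ i, f^[i] (m (f^[i] u)) = u := by
    intro i
    induction i with
    | zero => exact hmu
    | succ i ih =>
      rw [Function.iterate_succ_apply, Function.iterate_succ_apply' f i u]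
      have : f (m (f (f^[i] u))) = m (f^[i] u) := by
        simp only [f]
        rw [hm, hn]
      rw [this, ih]
  have hfS : ∀ i, f^[i] u ∈ S := by
    intro i
    induction i with
    | zero => exact huS
    | succ i ih =>
      rw [Function.iterate_succ_apply']
      exact hSn _ (hSm _ ih)
  have hTi : ∀ i, f^[i] u ∈ (range p).image fun i => f^[i] u := by
    intro i
    refine mem_image.2 ⟨i % p, mem_range.2 (Nat.mod_lt _ hp0), ?_⟩
    exact Function.iterate_mod_minimalPeriod_eq
  have hTm : ∀ v ∈ (range p).image fun i => f^[i] u, m v ∈ (range p).image fun i => f^[i] u := by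
    intro v hv
    obtain ⟨i, hi, rfl⟩ := mem_image.1 hv
    have : m (f^[i] u) = f^[p - i] u := by
      refine hf.iterate i ?_
      rw [hrefl, ← Function.iterate_add_apply, Nat.add_sub_cancel' (mem_range.1 hi).le, hperiod]
    show m (f^[i] u) ∈ _
    rw [this]
    exact hTi _
  have horb : ∀ v ∈ S, ∃ i < p, f^[i] u = v := by
    have hT := hclosed ((range p).image fun i => f^[i] u) (by
      intro v hv
      obtain ⟨i, -, rfl⟩ := mem_image.1 hv
      exact hfS i)
      ⟨u, mem_image.2 ⟨0, mem_range.2 hp0, rfl⟩⟩ (fun v hv => hTm v hv) (fun v hv => by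
        have h3 : n v = f (m v) := by
          simp only [f]
          rw [hm]
        obtain ⟨i, -, hi⟩ := mem_image.1 (hTm v hv)
        rw [h3, ← hi]
        show f (f^[i] u) ∈ _
        rw [← Function.iterate_succ_apply' f]
        exact hTi _)
    intro v hv
    rw [← hT] at hv
    obtain ⟨i, hi, rfl⟩ := mem_image.1 hv
    exact ⟨i, mem_range.1 hi, rfl⟩
  have hmfix : ∀ i, m (f^[i] u) = f^[i] u → p ∣ 2 * i := by
    intro i hi
    have := hrefl i
    rw [hi, ← Function.iterate_add_apply, ← two_mul] at this
    exact Function.isPeriodicPt_iff_minimalPeriod_dvd.1 this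
  have hnfix : ∀ i, n (f^[i + 1] u) = f^[i + 1] u → p ∣ 2 * i + 1 := by
    intro i hi
    have h3 := hrefl i
    rw [Function.iterate_succ_apply'] at hi
    have h4 : m (f^[i] u) = f (f^[i] u) := by
      rw [← hi]
      simp only [f]
      rw [hn]
    rw [h4, ← Function.iterate_succ_apply' f, ← Function.iterate_add_apply,
      show i + (i + 1) = 2 * i + 1 by ring] at h3
    exact Function.isPeriodicPt_iff_minimalPeriod_dvd.1 h3
  have hsub : {v ∈ S | m v = v} ⊆ {u, f^[p / 2] u} := by
    intro v hv
    obtain ⟨hvS, hmv⟩ := mem_filter.1 hv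
    obtain ⟨i, hi, rfl⟩ := horb v hvS
    obtain ⟨k, hk⟩ := hmfix i hmv
    have hk2 : k < 2 := by
      by_contra h
      nlinarith
    interval_cases k
    · have : i = 0 := by omega
      simp [this]
    · have : i = p / 2 := by omega
      simp [this]
  have key : #{v ∈ S | m v = v} ≤ 2 ∧ ∀ v ∈ S, n v ≠ v := by
    refine ⟨(card_le_card hsub).trans card_le_two, fun v hvS hnv => hk1 ?_⟩
    obtain ⟨i, hi, rfl⟩ := horb v hvS
    have hpo : Odd p := by
      rcases i with _ | i
      · exact absurd hnv hnu
      · exact Odd.of_dvd_nat ⟨i, rfl⟩ (hnfix i hnv)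
    rw [card_le_one]
    have : ∀ w ∈ ({v ∈ S | m v = v} : Finset V), w = u := by
      intro w hw
      obtain ⟨hwS, hmw⟩ := mem_filter.1 hw
      obtain ⟨j, hj, rfl⟩ := horb w hwS
      have : p ∣ j := (Nat.Coprime.dvd_mul_left (Nat.coprime_two_right.2 hpo)).1 (hmfix j hmw)
      rw [Nat.eq_zero_of_dvd_of_lt this hj]
      rfl
    intro a ha b hb
    rw [this a ha, this b hb]
  have := h2 S hSm hSn key.2 ⟨u, huS, hmu⟩
  omega
end

/-! ### Votes, spliced matchings and the sharpened inequality for dominant matchings -/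

namespace MarriageInstance
section
open Classical Finset

/-- The preference of one vertex between two sets of partners. -/
def PrefersRow {T : Type*} (r : T → ℕ) (P Q : T → Prop) : Prop :=
  ∃ t, P t ∧ ∀ t', Q t' → r t < r t'

/-- The vote of one vertex for the partners `P` against the partners `Q`. -/
noncomputable def voteRow {T : Type*} (r : T → ℕ) (P Q : T → Prop) : ℤ :=
  (if PrefersRow r P Q then 1 else 0) - (if PrefersRow r Q P then 1 else 0)

theorem voteRow_self {T : Type*} (r : T → ℕ) (P : T → Prop) : voteRow r P P = 0 := by
  simp [voteRow]

theorem voteRow_of_left_empty {T : Type*} (r : T → ℕ) (P Q : T → Prop) (hP : ∀ t, ¬ P t)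
    (hQ : ∃ t, Q t) : voteRow r P Q = -1 := by
  have h1 : ¬ PrefersRow r P Q := fun ⟨t, ht, _⟩ => hP t ht
  have h2 : PrefersRow r Q P := hQ.imp fun t ht => ⟨ht, fun t' ht' => (hP t' ht').elim⟩
  simp [voteRow, h1, h2]

theorem voteRow_of_right_empty {T : Type*} (r : T → ℕ) (P Q : T → Prop) (hQ : ∀ t, ¬ Q t)
    (hP : ∃ t, P t) : voteRow r P Q = 1 := by
  have h1 : ¬ PrefersRow r Q P := fun ⟨t, ht, _⟩ => hQ t ht
  have h2 : PrefersRow r P Q := hP.imp fun t ht => ⟨ht, fun t' ht' => (hQ t' ht').elim⟩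
  simp [voteRow, h1, h2]

theorem voteRow_of_mem {T : Type*} (r : T → ℕ) (P Q : T → Prop) {t s : T} (ht : P t) (hs : Q s)
    (hP : ∀ t', P t' → t' = t) (hQ : ∀ s', Q s' → s' = s) :
    voteRow r P Q = (if r t < r s then 1 else 0) - (if r s < r t then 1 else 0) := by
  have h1 : PrefersRow r P Q ↔ r t < r s :=
    ⟨fun ⟨t', h, h'⟩ => hP t' h ▸ h' s hs, fun h => ⟨t, ht, fun s' hs' => hQ s' hs' ▸ h⟩⟩
  have h2 : PrefersRow r Q P ↔ r s < r t :=
    ⟨fun ⟨t', h, h'⟩ => hQ t' h ▸ h' t ht, fun h => ⟨s, hs, fun s' hs' => hP s' hs' ▸ h⟩⟩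
  simp only [voteRow, h1, h2]

theorem odd_voteRow {T : Type*} (r : T → ℕ) (P Q : T → Prop)
    (hP : ∀ t t', P t → P t' → t = t') (hQ : ∀ t t', Q t → Q t' → t = t')
    (hr : ∀ t t', P t → Q t' → r t = r t' → t = t') (hne : ∃ t, ¬ (P t ↔ Q t)) :
    Odd (voteRow r P Q) := by
  by_cases h1 : ∃ t, P t
  · obtain ⟨t, ht⟩ := h1
    by_cases h2 : ∃ s, Q s
    · obtain ⟨s, hs⟩ := h2
      rw [voteRow_of_mem r P Q ht hs (fun t' h => hP _ _ h ht) (fun t' h => hQ _ _ h hs)]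
      have hne' : r t ≠ r s := by
        intro he
        have := hr t s ht hs he
        subst this
        obtain ⟨t', ht'⟩ := hne
        exact ht' ⟨fun h => hP _ _ h ht ▸ hs, fun h => hQ _ _ h hs ▸ ht⟩
      rcases lt_or_gt_of_ne hne' with h | h
      · simp [h, h.not_gt]
      · simp [h, h.not_gt]
    · rw [voteRow_of_right_empty r P Q (fun t h => h2 ⟨t, h⟩) ⟨t, ht⟩]
      exact odd_one
  · have h2 : ∃ s, Q s := by
      obtain ⟨t, h⟩ := hne
      by_contra h2
      exact h ⟨fun h => (h1 ⟨t, h⟩).elim, fun h => (h2 ⟨t, h⟩).elim⟩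
    rw [voteRow_of_left_empty r P Q (fun t h => h1 ⟨t, h⟩) h2]
    decide

variable {A B : Type*}

/-- The partner of a vertex in `M`, or the vertex itself if it is unmatched. -/
noncomputable def mate (M : Finset (A × B)) : A ⊕ B → A ⊕ B
  | .inl a => if h : MatchedA M a then .inr h.choose else .inl a
  | .inr b => if h : MatchedB M b then .inl h.choose else .inr b

/-- The vote of a vertex for `M` against `N`. -/
noncomputable def vertexVote (G : MarriageInstance A B) (M N : Finset (A × B)) : A ⊕ B → ℤ
  | .inl a => voteRow (G.rankA a) (fun b => (a, b) ∈ M) (fun b => (a, b) ∈ N)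
  | .inr b => voteRow (G.rankB b) (fun a => (a, b) ∈ M) (fun a => (a, b) ∈ N)

variable {G : MarriageInstance A B} {M N : Finset (A × B)}

theorem IsMatching.eq_right (hM : G.IsMatching M) {a b b'} (h : (a, b) ∈ M) (h' : (a, b') ∈ M) :
    b = b' :=
  (Prod.ext_iff.1 (hM.2.1 _ h _ h' rfl)).2

theorem IsMatching.eq_left (hM : G.IsMatching M) {a a' b} (h : (a, b) ∈ M) (h' : (a', b) ∈ M) :
    a = a' :=
  (Prod.ext_iff.1 (hM.2.2 _ h _ h' rfl)).1

theorem IsMatching.mate_inl (hM : G.IsMatching M) {a b} (h : (a, b) ∈ M) :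
    mate M (.inl a) = .inr b := by
  have h1 : MatchedA M a := ⟨b, h⟩
  simp only [mate, h1, dif_pos]
  rw [hM.eq_right h1.choose_spec h]

theorem IsMatching.mate_inr (hM : G.IsMatching M) {a b} (h : (a, b) ∈ M) :
    mate M (.inr b) = .inl a := by
  have h1 : MatchedB M b := ⟨a, h⟩
  simp only [mate, h1, dif_pos]
  rw [hM.eq_left h1.choose_spec h]

theorem mate_inl_of_not {a : A} (h : ¬ MatchedA M a) : mate M (.inl a) = .inl a := by
  simp [mate, h]

theorem mate_inr_of_not {b : B} (h : ¬ MatchedB M b) : mate M (.inr b) = .inr b := by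
  simp [mate, h]

theorem IsMatching.mate_inl_eq_iff (hM : G.IsMatching M) {a : A} :
    mate M (.inl a) = .inl a ↔ ¬ MatchedA M a :=
  ⟨fun h ⟨b, hb⟩ => by simp [hM.mate_inl hb] at h, mate_inl_of_not⟩

theorem IsMatching.mate_inr_eq_iff (hM : G.IsMatching M) {b : B} :
    mate M (.inr b) = .inr b ↔ ¬ MatchedB M b :=
  ⟨fun h ⟨a, ha⟩ => by simp [hM.mate_inr ha] at h, mate_inr_of_not⟩

theorem IsMatching.mate_involutive (hM : G.IsMatching M) : Function.Involutive (mate M) := by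
  rintro (a | b)
  · by_cases h : MatchedA M a
    · obtain ⟨b, hb⟩ := h
      rw [hM.mate_inl hb, hM.mate_inr hb]
    · rw [mate_inl_of_not h, mate_inl_of_not h]
  · by_cases h : MatchedB M b
    · obtain ⟨a, ha⟩ := h
      rw [hM.mate_inr ha, hM.mate_inl ha]
    · rw [mate_inr_of_not h, mate_inr_of_not h]

theorem odd_vertexVote (hM : G.IsMatching M) (hN : G.IsMatching N) (u : A ⊕ B)
    (h : mate N u ≠ mate M u) : Odd (G.vertexVote M N u) := by
  rcases u with a | b
  · refine odd_voteRow _ _ _ (fun _ _ => hM.eq_right) (fun _ _ => hN.eq_right)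
      (fun b b' hb hb' => G.rankA_strict a b b' (hM.1 hb) (hN.1 hb')) ?_
    by_contra hne
    push Not at hne
    apply h
    by_cases h1 : MatchedA M a
    · obtain ⟨b, hb⟩ := h1
      rw [hM.mate_inl hb, hN.mate_inl ((hne b).1 hb)]
    · rw [mate_inl_of_not h1, mate_inl_of_not fun ⟨b, hb⟩ => h1 ⟨b, (hne b).2 hb⟩]
  · refine odd_voteRow _ _ _ (fun _ _ => hM.eq_left) (fun _ _ => hN.eq_left)
      (fun b b' hb hb' => G.rankB_strict _ _ _ (hM.1 hb) (hN.1 hb')) ?_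
    by_contra hne
    push Not at hne
    apply h
    by_cases h1 : MatchedB M b
    · obtain ⟨a, hb⟩ := h1
      rw [hM.mate_inr hb, hN.mate_inr ((hne a).1 hb)]
    · rw [mate_inr_of_not h1, mate_inr_of_not fun ⟨b, hb⟩ => h1 ⟨b, (hne b).2 hb⟩]

/-- The matching that agrees with `N` on `S` and with `M` elsewhere. -/
noncomputable def splice (S : Finset (A ⊕ B)) (N M : Finset (A × B)) : Finset (A × B) :=
  {e ∈ N | .inl e.1 ∈ S} ∪ {e ∈ M | .inl e.1 ∉ S}

theorem mem_splice_left {S : Finset (A ⊕ B)} {a : A} {b : B} :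
    (a, b) ∈ splice S N M ↔ if .inl a ∈ S then (a, b) ∈ N else (a, b) ∈ M := by
  by_cases h : .inl a ∈ S <;> simp [splice, h]

/-- The definition tests the endpoint in `A`; as `S` is closed under both mate maps, testing the
endpoint in `B` gives the same set. -/
theorem mem_splice_right {S : Finset (A ⊕ B)} (hM : G.IsMatching M) (hN : G.IsMatching N)
    (hSM : ∀ u ∈ S, mate M u ∈ S) (hSN : ∀ u ∈ S, mate N u ∈ S) {a : A} {b : B} :
    (a, b) ∈ splice S N M ↔ if .inr b ∈ S then (a, b) ∈ N else (a, b) ∈ M := by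
  have h1 : ∀ {K : Finset (A × B)}, G.IsMatching K → (∀ u ∈ S, mate K u ∈ S) → (a, b) ∈ K →
      (Sum.inl a ∈ S ↔ Sum.inr b ∈ S) := fun hK hS h =>
    ⟨fun h' => hK.mate_inl h ▸ hS _ h', fun h' => hK.mate_inr h ▸ hS _ h'⟩
  have hM' := h1 hM hSM
  have hN' := h1 hN hSN
  rw [mem_splice_left]
  split_ifs with h2 h3 h3 <;> tauto

theorem isMatching_splice {S : Finset (A ⊕ B)} (hM : G.IsMatching M) (hN : G.IsMatching N)
    (hSM : ∀ u ∈ S, mate M u ∈ S) (hSN : ∀ u ∈ S, mate N u ∈ S) :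
    G.IsMatching (splice S N M) := by
  refine ⟨?_, ?_, ?_⟩
  · refine union_subset ((filter_subset _ _).trans hN.1) ((filter_subset _ _).trans hM.1)
  · rintro ⟨a, b⟩ he ⟨a', b'⟩ hf (rfl : a = a')
    rw [mem_splice_left] at he hf
    split_ifs at he hf
    · rw [hN.eq_right he hf]
    · rw [hM.eq_right he hf]
  · rintro ⟨a, b⟩ he ⟨a', b'⟩ hf (rfl : b = b')
    rw [mem_splice_right hM hN hSM hSN] at he hf
    split_ifs at he hf
    · rw [hN.eq_left he hf]
    · rw [hM.eq_left he hf]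

theorem vertexVote_splice {S : Finset (A ⊕ B)} (hM : G.IsMatching M) (hN : G.IsMatching N)
    (hSM : ∀ u ∈ S, mate M u ∈ S) (hSN : ∀ u ∈ S, mate N u ∈ S) (u : A ⊕ B) :
    G.vertexVote (splice S N M) M u = if u ∈ S then G.vertexVote N M u else 0 := by
  rcases u with a | b
  · simp only [vertexVote, mem_splice_left]
    split_ifs
    · rfl
    · exact voteRow_self _ _
  · simp only [vertexVote, mem_splice_right hM hN hSM hSN]
    split_ifs
    · rfl
    · exact voteRow_self _ _

theorem IsMatching.card_eq_card_matchedA [Fintype A] (hM : G.IsMatching M) :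
    #M = #{a : A | MatchedA M a} := by
  rw [← card_image_of_injOn (s := M) (f := Prod.fst) fun e he f hf => hM.2.1 e he f hf]
  congr 1
  ext a
  rw [mem_image, mem_filter]
  simp [MatchedA]

theorem IsMatching.card_eq_card_matchedB [Fintype B] (hM : G.IsMatching M) :
    #M = #{b : B | MatchedB M b} := by
  rw [← card_image_of_injOn (s := M) (f := Prod.snd) fun e he f hf => hM.2.2 e he f hf]
  congr 1
  ext a
  rw [mem_image, mem_filter]
  simp [MatchedB]

section
variable [Fintype A] [Fintype B]

theorem sum_vertexVote : ∑ u, G.vertexVote M N u = (G.votes M N : ℤ) - G.votes N M := by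
  have h : ∀ M N : Finset (A × B), (G.votes M N : ℤ) =
      (∑ a, if PrefersRow (G.rankA a) (fun b => (a, b) ∈ M) (fun b => (a, b) ∈ N) then 1 else 0) +
      ∑ b, if PrefersRow (G.rankB b) (fun a => (a, b) ∈ M) (fun a => (a, b) ∈ N)
        then 1 else 0 := by
    intro M N
    rw [votes, card_filter, card_filter]
    push_cast
    rfl
  rw [Fintype.sum_sum_type, h M N, h N M]
  simp only [vertexVote, voteRow, sum_sub_distrib]
  ring

/-- The number of vertices that are matched in `N` but not in `M`. -/
noncomputable def numNewlyMatched (N M : Finset (A × B)) : ℕ :=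
  #{a : A | ¬ MatchedA M a ∧ MatchedA N a} + #{b : B | ¬ MatchedB M b ∧ MatchedB N b}

/-- The counting lemma for involutions is applied to the two mate maps. An invariant set `S` yields
a competitor that follows `N` on `S` and `M` elsewhere, so its total vote against `M` is the sum
over `S`, nonpositive by popularity. If `N` covers `S` and `M` does not, the competitor is larger
than `M`, and dominance makes the sum negative. -/
theorem IsDominant.votes_add_numNewlyMatched_le (hD : G.IsDominant M) (hN : G.IsMatching N) :
    G.votes N M + numNewlyMatched N M ≤ G.votes M N := by
  have hM := hD.1.1
  have hsum : ∀ S : Finset (A ⊕ B), (∀ u ∈ S, mate M u ∈ S) → (∀ u ∈ S, mate N u ∈ S) →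
      ∑ u ∈ S, G.vertexVote N M u = (G.votes (splice S N M) M : ℤ) - G.votes M (splice S N M) := by
    intro S hSM hSN
    rw [← sum_vertexVote]
    simp only [vertexVote_splice hM hN hSM hSN, sum_ite_mem, univ_inter]
  have h := sum_add_card_fixed_le_zero (mate M) (mate N) hM.mate_involutive hN.mate_involutive
    (G.vertexVote N M) (fun u hu => odd_vertexVote hN hM u hu) ?_ ?_ univ (by simp) (by simp)
  · rw [sum_vertexVote] at h
    have h2 : #{u : A ⊕ B | mate M u = u ∧ mate N u ≠ u} = numNewlyMatched N M := by
      simp only [card_filter, numNewlyMatched, Fintype.sum_sum_type, ne_eq, hM.mate_inl_eq_iff,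
        hN.mate_inl_eq_iff, hM.mate_inr_eq_iff, hN.mate_inr_eq_iff, not_not]
    have h3 : (G.votes N M : ℤ) - G.votes M N + numNewlyMatched N M ≤ 0 := by
      rw [← h2]
      convert h
    omega
  · intro S hSM hSN
    rw [hsum S hSM hSN]
    have := hD.1.2 _ (isMatching_splice hM hN hSM hSN)
    omega
  · intro S hSM hSN hfree hfix
    rw [hsum S hSM hSN]
    have hL := isMatching_splice hM hN hSM hSN
    have hA : ∀ a, MatchedA M a ∨ .inl a ∈ S → MatchedA (splice S N M) a := by
      intro a ha
      by_cases haS : .inl a ∈ S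
      · obtain ⟨b, hb⟩ := not_not.1 (mt hN.mate_inl_eq_iff.2 (hfree _ haS))
        exact ⟨b, mem_splice_left.2 (by simpa [haS] using hb)⟩
      · obtain ⟨b, hb⟩ := ha.resolve_right haS
        exact ⟨b, mem_splice_left.2 (by simpa [haS] using hb)⟩
    have hB : ∀ b, MatchedB M b ∨ .inr b ∈ S → MatchedB (splice S N M) b := by
      intro b hb
      by_cases hbS : .inr b ∈ S
      · obtain ⟨a, ha⟩ := not_not.1 (mt hN.mate_inr_eq_iff.2 (hfree _ hbS))
        exact ⟨a, (mem_splice_right hM hN hSM hSN).2 (by simpa [hbS] using ha)⟩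
      · obtain ⟨a, ha⟩ := hb.resolve_right hbS
        exact ⟨a, (mem_splice_right hM hN hSM hSN).2 (by simpa [hbS] using ha)⟩
    have hcard : #M < #(splice S N M) := by
      obtain ⟨a | b, huS, hu⟩ := hfix
      · rw [hM.card_eq_card_matchedA, hL.card_eq_card_matchedA]
        refine card_lt_card ⟨fun a ha => ?_, fun h => ?_⟩
        · simp only [mem_filter, mem_univ, true_and] at ha ⊢
          exact hA a (.inl ha)
        · have := h (mem_filter.2 ⟨mem_univ a, hA a (.inr huS)⟩)
          exact hM.mate_inl_eq_iff.1 hu (mem_filter.1 this).2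
      · rw [hM.card_eq_card_matchedB, hL.card_eq_card_matchedB]
        refine card_lt_card ⟨fun a ha => ?_, fun h => ?_⟩
        · simp only [mem_filter, mem_univ, true_and] at ha ⊢
          exact hB a (.inl ha)
        · have := h (mem_filter.2 ⟨mem_univ b, hB b (.inr huS)⟩)
          exact hM.mate_inr_eq_iff.1 hu (mem_filter.1 this).2
    have := hD.2 _ hL hcard
    omega

theorem IsDominant.isMaxPopular (hD : G.IsDominant M) : G.IsMaxPopular M := by
  refine ⟨hD.1, fun N hN => ?_⟩
  by_contra h
  have h1 := hD.2 N hN.1 (by omega)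
  have h2 := hN.2 M hD.1.1
  omega

/-- Two popular matchings tie, so the sharpened inequality leaves no room for a newly matched
vertex. This identifies U with the set of vertices unmatched in any dominant matching. -/
theorem IsDominant.numNewlyMatched_eq_zero (hD : G.IsDominant M) (hN : G.IsPopular N) :
    numNewlyMatched N M = 0 := by
  have h1 := hD.votes_add_numNewlyMatched_le hN.1
  have h2 := hN.2 M hD.1.1
  omega

theorem IsDominant.unpopularA_iff (hD : G.IsDominant M) (a : A) :
    G.UnpopularA a ↔ ¬ MatchedA M a := by
  refine ⟨fun h => h M hD.isMaxPopular, fun h N hN hNa => ?_⟩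
  have h1 := hD.numNewlyMatched_eq_zero hN.1
  rw [numNewlyMatched, Nat.add_eq_zero_iff, card_eq_zero, card_eq_zero] at h1
  have : a ∈ (∅ : Finset A) := h1.1 ▸ mem_filter.2 ⟨mem_univ a, h, hNa⟩
  simp at this

theorem IsDominant.unpopularB_iff (hD : G.IsDominant M) (b : B) :
    G.UnpopularB b ↔ ¬ MatchedB M b := by
  refine ⟨fun h => h M hD.isMaxPopular, fun h N hN hNa => ?_⟩
  have h1 := hD.numNewlyMatched_eq_zero hN.1
  rw [numNewlyMatched, Nat.add_eq_zero_iff, card_eq_zero, card_eq_zero] at h1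
  have : b ∈ (∅ : Finset B) := h1.2 ▸ mem_filter.2 ⟨mem_univ b, h, hNa⟩
  simp at this

end
end
end MarriageInstance

/-! ### Dominance certificates and validity of the constraints -/

namespace MarriageInstance
section
open Classical Finset

/-- The vote of one vertex for the partner `t` against the partners `Q`, and `2` if `Q` is
empty. -/
noncomputable def shiftVote {T : Type*} (r : T → ℕ) (Q : T → Prop) (t : T) : ℝ :=
  if ∃ s, Q s then (voteRow r (· = t) Q : ℝ) else 2

/-- The vote of one vertex for the partner `t` against the fractional assignment `w`. -/
noncomputable def rowVote {T : Type*} [Fintype T] (r : T → ℕ) (w : T → ℝ) (t : T) : ℝ :=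
  (∑ s, if r t < r s then w s else 0) - ∑ s, if r s < r t then w s else 0

theorem shiftVote_of_mem {T : Type*} (r : T → ℕ) {Q : T → Prop} (t : T) {s : T} (hs : Q s)
    (hQ : ∀ s', Q s' → s' = s) :
    shiftVote r Q t = (if r t < r s then 1 else 0) - (if r s < r t then 1 else 0) := by
  rw [shiftVote, if_pos ⟨s, hs⟩, voteRow_of_mem r (· = t) Q rfl hs (fun _ h => h) hQ]
  push_cast
  rfl

/-- This is the source of the value 2: a newly matched vertex contributes 1 by its vote and 1 to the
count of newly matched vertices. -/
theorem voteRow_add_eq_shiftVote {T : Type*} (r : T → ℕ) (P Q : T → Prop) {t : T} (ht : P t)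
    (hP : ∀ t', P t' → t' = t) :
    (voteRow r P Q : ℝ) + (if (¬ ∃ s, Q s) ∧ ∃ s, P s then 1 else 0) = shiftVote r Q t := by
  have : P = (· = t) := funext fun t' => propext ⟨hP t', fun h => h ▸ ht⟩
  subst this
  by_cases hQ : ∃ s, Q s
  · simp [shiftVote, hQ]
  · rw [voteRow_of_right_empty r (fun x => x = t) Q (not_exists.1 hQ) ⟨t, rfl⟩]
    simp [shiftVote, hQ]
    norm_num

theorem voteRow_add_of_left_empty {T : Type*} (r : T → ℕ) (P Q : T → Prop) (hP : ¬ ∃ t, P t) :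
    (voteRow r P Q : ℝ) + (if (¬ ∃ s, Q s) ∧ ∃ s, P s then 1 else 0) =
      if ∃ s, Q s then -1 else 0 := by
  by_cases hQ : ∃ s, Q s
  · rw [voteRow_of_left_empty r P Q (not_exists.1 hP) hQ]
    simp [hQ]
  · have h1 : P = Q := funext fun t => propext
      ⟨fun h => (hP ⟨t, h⟩).elim, fun h => (hQ ⟨t, h⟩).elim⟩
    subst h1
    simp [voteRow_self, hQ]

theorem rowVote_indicator {T : Type*} [Fintype T] (r : T → ℕ) {Q : T → Prop} (t : T) {s : T}
    (hs : Q s) (hQ : ∀ s', Q s' → s' = s) :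
    rowVote r (fun s => if Q s then 1 else 0) t = shiftVote r Q t := by
  have : Q = (· = s) := funext fun t' => propext ⟨hQ t', fun h => h ▸ hs⟩
  subst this
  rw [shiftVote_of_mem (Q := fun x => x = s) r t hs hQ, rowVote]
  congr 1
  · rw [sum_eq_single s] <;> simp +contextual
  · rw [sum_eq_single s] <;> simp +contextual

variable {A B : Type*} (G : MarriageInstance A B)

/-- The vote of `a` for `b` against `M`, and `2` if `a` is unmatched in `M`. -/
noncomputable def shiftVoteA (M : Finset (A × B)) (a : A) (b : B) : ℝ :=
  shiftVote (G.rankA a) (fun b' => (a, b') ∈ M) b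

/-- The vote of `b` for `a` against `M`, and `2` if `b` is unmatched in `M`. -/
noncomputable def shiftVoteB (M : Finset (A × B)) (b : B) (a : A) : ℝ :=
  shiftVote (G.rankB b) (fun a' => (a', b) ∈ M) a

/-- The entry of `x` at the pair `(a, b)`, zero if the pair is not an edge. -/
noncomputable def entry (x : G.edges → ℝ) (a : A) (b : B) : ℝ :=
  if h : (a, b) ∈ G.edges then x ⟨(a, b), h⟩ else 0

theorem sum_edges_eq_sum_right [Fintype B] (x : G.edges → ℝ) (a : A) (p : B → Prop) :
    (∑ e : G.edges, if e.1.1 = a ∧ p e.1.2 then x e else 0) =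
      ∑ b, if p b then G.entry x a b else 0 := by
  have h1 : ∀ e : G.edges, x e = G.entry x e.1.1 e.1.2 := fun e => by simp [entry]
  simp_rw [h1]
  rw [sum_coe_sort G.edges fun e => if e.1 = a ∧ p e.2 then G.entry x e.1 e.2 else 0, ← sum_filter,
    ← sum_filter]
  have h2 : ∑ b with p b, G.entry x a b = ∑ b with p b ∧ (a, b) ∈ G.edges, G.entry x a b := by
    refine (sum_subset (monotone_filter_right _ fun _ _ h => h.1) fun b hb hb' => ?_).symm
    have hab : (a, b) ∉ G.edges := fun h =>
      hb' (mem_filter.2 ⟨mem_univ _, (mem_filter.1 hb).2, h⟩)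
    simp [entry, hab]
  rw [h2]
  refine sum_nbij' Prod.snd (fun b => (a, b)) ?_ ?_ ?_ ?_ ?_
  · rintro ⟨a', b⟩ h
    simp only [mem_filter] at h
    obtain ⟨hE, rfl, hp⟩ := h
    simp [hE, hp]
  · intro b hb
    simp only [mem_filter, mem_univ, true_and] at hb
    simp [hb.1, hb.2]
  · rintro ⟨a', b⟩ h
    simp only [mem_filter] at h
    simp [h.2.1]
  · simp
  · rintro ⟨a', b⟩ h
    simp only [mem_filter] at h
    simp [h.2.1]

theorem sum_edges_eq_sum_left [Fintype A] (x : G.edges → ℝ) (b : B) (p : A → Prop) :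
    (∑ e : G.edges, if e.1.2 = b ∧ p e.1.1 then x e else 0) =
      ∑ a, if p a then G.entry x a b else 0 := by
  have h1 : ∀ e : G.edges, x e = G.entry x e.1.1 e.1.2 := fun e => by simp [entry]
  simp_rw [h1]
  rw [sum_coe_sort G.edges fun e => if e.2 = b ∧ p e.1 then G.entry x e.1 e.2 else 0, ← sum_filter,
    ← sum_filter]
  have h2 : ∑ a with p a, G.entry x a b = ∑ a with p a ∧ (a, b) ∈ G.edges, G.entry x a b := by
    refine (sum_subset (monotone_filter_right _ fun _ _ h => h.1) fun a hb hb' => ?_).symm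
    have hab : (a, b) ∉ G.edges := fun h =>
      hb' (mem_filter.2 ⟨mem_univ _, (mem_filter.1 hb).2, h⟩)
    simp [entry, hab]
  rw [h2]
  refine sum_nbij' Prod.fst (fun a => (a, b)) ?_ ?_ ?_ ?_ ?_
  · rintro ⟨a, b'⟩ h
    simp only [mem_filter] at h
    obtain ⟨hE, rfl, hp⟩ := h
    simp [hE, hp]
  · intro b hb
    simp only [mem_filter, mem_univ, true_and] at hb
    simp [hb.1, hb.2]
  · rintro ⟨a', b⟩ h
    simp only [mem_filter] at h
    simp [h.2.1]
  · simp
  · rintro ⟨a', b⟩ h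
    simp only [mem_filter] at h
    simp [h.2.1]

theorem degreeA_eq [Fintype B] (x : G.edges → ℝ) (a : A) :
    G.degreeA x a = ∑ b, G.entry x a b := by
  have := G.sum_edges_eq_sum_right x a fun _ => True
  simpa [degreeA] using this

theorem degreeB_eq [Fintype A] (x : G.edges → ℝ) (b : B) :
    G.degreeB x b = ∑ a, G.entry x a b := by
  have := G.sum_edges_eq_sum_left x b fun _ => True
  simpa [degreeB] using this

theorem voteA_eq [Fintype B] (x : G.edges → ℝ) (a : A) (b : B) :
    G.voteA x a b = rowVote (G.rankA a) (G.entry x a) b := by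
  rw [rowVote, voteA]
  convert congr_arg₂ (· - ·)
    (G.sum_edges_eq_sum_right x a fun b' => G.rankA a b < G.rankA a b')
    (G.sum_edges_eq_sum_right x a fun b' => G.rankA a b' < G.rankA a b)

theorem voteB_eq [Fintype A] (x : G.edges → ℝ) (b : B) (a : A) :
    G.voteB x b a = rowVote (G.rankB b) (fun a => G.entry x a b) a := by
  rw [rowVote, voteB]
  convert congr_arg₂ (· - ·)
    (G.sum_edges_eq_sum_left x b fun a' => G.rankB b a < G.rankB b a')
    (G.sum_edges_eq_sum_left x b fun a' => G.rankB b a' < G.rankB b a)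

variable {G} {M N : Finset (A × B)}

theorem entry_incidence (hM : G.IsMatching M) (a : A) (b : B) :
    G.entry (G.incidence M) a b = if (a, b) ∈ M then 1 else 0 := by
  by_cases h : (a, b) ∈ G.edges
  · simp [entry, incidence, h]
  · have h1 : (a, b) ∉ M := fun h' => h (hM.1 h')
    simp [entry, h, h1]

variable [Fintype A] [Fintype B]

/-- The quantity that dominance bounds by zero is the weight of `N` in a matching problem, with
weights on the edges and on the unmatched vertices. Potentials can therefore certify it. -/
theorem votes_sub_votes_add_eq (hN : G.IsMatching N) :
    (G.votes N M : ℝ) - G.votes M N + numNewlyMatched N M =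
      ∑ e ∈ N, (G.shiftVoteA M e.1 e.2 + G.shiftVoteB M e.2 e.1) +
        (∑ a, if MatchedA N a then 0 else if MatchedA M a then -1 else 0) +
        ∑ b, if MatchedB N b then 0 else if MatchedB M b then -1 else 0 := by
  have h1 : ((∑ u, G.vertexVote N M u : ℤ) : ℝ) = (G.votes N M : ℝ) - G.votes M N := by
    rw [sum_vertexVote]
    push_cast
    rfl
  have h2 : ((numNewlyMatched N M : ℕ) : ℝ) =
      (∑ a, if (¬ MatchedA M a) ∧ MatchedA N a then 1 else 0) +
        ∑ b, if (¬ MatchedB M b) ∧ MatchedB N b then 1 else 0 := by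
    rw [numNewlyMatched, card_filter, card_filter]
    push_cast
    rfl
  let hA : A → ℝ := fun a => (G.vertexVote N M (.inl a) : ℝ) +
    if (¬ MatchedA M a) ∧ MatchedA N a then 1 else 0
  let hB : B → ℝ := fun b => (G.vertexVote N M (.inr b) : ℝ) +
    if (¬ MatchedB M b) ∧ MatchedB N b then 1 else 0
  have h3 : (G.votes N M : ℝ) - G.votes M N + numNewlyMatched N M = ∑ a, hA a + ∑ b, hB b := by
    rw [← h1, h2, Fintype.sum_sum_type]
    simp only [hA, hB, sum_add_distrib]
    push_cast
    ring
  rw [h3, sum_eq_sum_fst_add N hN.2.1 hA, sum_eq_sum_snd_add N hN.2.2 hB]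
  have e1 : ∑ e ∈ N, hA e.1 = ∑ e ∈ N, G.shiftVoteA M e.1 e.2 := by
    refine sum_congr rfl ?_
    rintro ⟨a, b⟩ he
    exact voteRow_add_eq_shiftVote (G.rankA a) (fun b => (a, b) ∈ N) (fun b => (a, b) ∈ M) he
      fun b' hb' => hN.eq_right hb' he
  have e2 : ∑ e ∈ N, hB e.2 = ∑ e ∈ N, G.shiftVoteB M e.2 e.1 := by
    refine sum_congr rfl ?_
    rintro ⟨a, b⟩ he
    exact voteRow_add_eq_shiftVote (G.rankB b) (fun a => (a, b) ∈ N) (fun a => (a, b) ∈ M) he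
      fun b' hb' => hN.eq_left hb' he
  have e3 : ∀ a, (if MatchedA N a then (0 : ℝ) else hA a) =
      if MatchedA N a then 0 else if MatchedA M a then -1 else 0 := by
    intro a
    split_ifs with h4 h5
    · rfl
    · exact (voteRow_add_of_left_empty (G.rankA a) _ _ h4).trans (if_pos h5)
    · exact (voteRow_add_of_left_empty (G.rankA a) _ _ h4).trans (if_neg h5)
  have e4 : ∀ b, (if MatchedB N b then (0 : ℝ) else hB b) =
      if MatchedB N b then 0 else if MatchedB M b then -1 else 0 := by
    intro b
    split_ifs with h4 h5
    · rfl
    · exact (voteRow_add_of_left_empty (G.rankB b) _ _ h4).trans (if_pos h5)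
    · exact (voteRow_add_of_left_empty (G.rankB b) _ _ h4).trans (if_neg h5)
  rw [e1, e2, sum_congr rfl fun a _ => e3 a, sum_congr rfl fun b _ => e4 b, sum_add_distrib]
  ring

/-- Potentials that certify that `M` is dominant. -/
theorem isDominant_of_potential (hM : G.IsMatching M) (α : A → ℝ) (β : B → ℝ)
    (hα0 : ∀ a, ¬ MatchedA M a → α a = 0) (hβ0 : ∀ b, ¬ MatchedB M b → β b = 0)
    (hα : ∀ a, MatchedA M a → -1 ≤ α a) (hβ : ∀ b, MatchedB M b → -1 ≤ β b)
    (htight : ∀ a b, (a, b) ∈ M → α a + β b = 0)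
    (hcov : ∀ a b, (a, b) ∈ G.edges → G.shiftVoteA M a b + G.shiftVoteB M b a ≤ α a + β b) :
    G.IsDominant M := by
  have hsum : ∑ a, α a + ∑ b, β b = 0 := by
    rw [sum_eq_sum_fst_add M hM.2.1 α, sum_eq_sum_snd_add M hM.2.2 β]
    have h1 : ∀ a, (if MatchedA M a then 0 else α a) = 0 := fun a => by
      split_ifs with h
      exacts [rfl, hα0 a h]
    have h2 : ∀ b, (if MatchedB M b then 0 else β b) = 0 := fun b => by
      split_ifs with h
      exacts [rfl, hβ0 b h]
    simp only [h1, h2, sum_const_zero, add_zero]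
    rw [← sum_add_distrib]
    exact sum_eq_zero fun e he => htight e.1 e.2 he
  -- Weak duality: the weight of `N` is at most the total of the potentials, which is zero because
  -- they vanish on the unmatched vertices and cancel along `M`.
  have key : ∀ N, G.IsMatching N → G.votes N M + numNewlyMatched N M ≤ G.votes M N := by
    intro N hN
    have h1 := votes_sub_votes_add_eq (M := M) hN
    rw [sum_eq_sum_fst_add N hN.2.1 α, sum_eq_sum_snd_add N hN.2.2 β] at hsum
    have h2 : ∑ e ∈ N, (G.shiftVoteA M e.1 e.2 + G.shiftVoteB M e.2 e.1) ≤
        ∑ e ∈ N, (α e.1 + β e.2) := sum_le_sum fun e he => hcov e.1 e.2 (hN.1 he)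
    have h3 : (∑ a, if MatchedA N a then (0 : ℝ) else if MatchedA M a then -1 else 0) ≤
        ∑ a, if MatchedA N a then 0 else α a := by
      refine sum_le_sum fun a _ => ?_
      split_ifs with h4 h5
      exacts [le_rfl, hα a h5, (hα0 a h5).ge]
    have h4 : (∑ b, if MatchedB N b then (0 : ℝ) else if MatchedB M b then -1 else 0) ≤
        ∑ b, if MatchedB N b then 0 else β b := by
      refine sum_le_sum fun a _ => ?_
      split_ifs with h4 h5
      exacts [le_rfl, hβ a h5, (hβ0 a h5).ge]
    rw [sum_add_distrib (f := fun e : A × B => α e.1)] at h2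
    have h5 : (G.votes N M : ℝ) + numNewlyMatched N M ≤ G.votes M N := by linarith
    exact_mod_cast h5
  refine ⟨⟨hM, fun N hN => (Nat.le_add_right _ _).trans (key N hN)⟩, fun N hN hcard => ?_⟩
  have h1 := key N hN
  suffices 0 < numNewlyMatched N M by omega
  rw [Nat.pos_iff_ne_zero]
  intro h0
  rw [numNewlyMatched, Nat.add_eq_zero_iff, card_eq_zero] at h0
  rw [hM.card_eq_card_matchedA, hN.card_eq_card_matchedA] at hcard
  refine hcard.not_ge (card_le_card fun a ha => ?_)
  rw [mem_filter] at ha ⊢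
  refine ⟨ha.1, ?_⟩
  by_contra h
  exact notMem_empty a (h0.1 ▸ mem_filter.2 ⟨mem_univ a, h, ha.2⟩)

/-- The weight of the edge `(a, b)` in the constraints that belong to matchings. -/
noncomputable def edgeWeight (G : MarriageInstance A B) (x : G.edges → ℝ) (a : A) (b : B) : ℝ :=
  (if G.UnpopularA a then 2 else G.voteA x a b) + if G.UnpopularB b then 2 else G.voteB x b a

/-- With the number of matched unpopular vertices moved to the left, a constraint takes the same
form as the sharpened inequality: such a vertex counts once for its vote and once for that number,
which gives 2 again. -/
theorem wt_add_numUnpopularMatched_eq (x : G.edges → ℝ) (hN : G.IsMatching N) :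
    G.wt x N + G.numUnpopularMatched N =
      ∑ e ∈ N, G.edgeWeight x e.1 e.2 +
        (∑ a, if MatchedA N a then 0 else if G.UnpopularA a then 0 else -1) +
        ∑ b, if MatchedB N b then 0 else if G.UnpopularB b then 0 else -1 := by
  let hA : A → ℝ := fun a => G.matchVoteA x N a +
    if G.UnpopularA a ∧ MatchedA N a then 1 else 0
  let hB : B → ℝ := fun b => G.matchVoteB x N b +
    if G.UnpopularB b ∧ MatchedB N b then 1 else 0
  have h3 : G.wt x N + G.numUnpopularMatched N = ∑ a, hA a + ∑ b, hB b := by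
    simp only [hA, hB, sum_add_distrib, wt, numUnpopularMatched, card_filter]
    push_cast
    ring
  rw [h3, sum_eq_sum_fst_add N hN.2.1 hA, sum_eq_sum_snd_add N hN.2.2 hB]
  simp only [edgeWeight, sum_add_distrib]
  have e1 : ∑ e ∈ N, hA e.1 = ∑ e ∈ N, if G.UnpopularA e.1 then 2 else G.voteA x e.1 e.2 := by
    refine sum_congr rfl ?_
    rintro ⟨a, b⟩ he
    have h : MatchedA N a := ⟨b, he⟩
    by_cases hU : G.UnpopularA a
    · simp only [hA, matchVoteA, hU, h, if_true, true_and]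
      norm_num
    · have := hN.eq_right h.choose_spec he
      simp [hA, matchVoteA, hU, h, this]
  have e2 : ∑ e ∈ N, hB e.2 = ∑ e ∈ N, if G.UnpopularB e.2 then 2 else G.voteB x e.2 e.1 := by
    refine sum_congr rfl ?_
    rintro ⟨a, b⟩ he
    have h : MatchedB N b := ⟨a, he⟩
    by_cases hU : G.UnpopularB b
    · simp only [hB, matchVoteB, hU, h, if_true, true_and]
      norm_num
    · have := hN.eq_left h.choose_spec he
      simp [hB, matchVoteB, hU, h, this]
  have e3 : ∀ a, (if MatchedA N a then (0 : ℝ) else hA a) =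
      if MatchedA N a then 0 else if G.UnpopularA a then 0 else -1 := by
    intro a
    split_ifs with h4 h5 <;> simp [hA, matchVoteA, *]
  have e4 : ∀ b, (if MatchedB N b then (0 : ℝ) else hB b) =
      if MatchedB N b then 0 else if G.UnpopularB b then 0 else -1 := by
    intro a
    split_ifs with h4 h5 <;> simp [hB, matchVoteB, *]
  simp only [e1, e2, e3, e4]
  ring

theorem IsDominant.edgeWeight_incidence (hD : G.IsDominant M) (a : A) (b : B) :
    G.edgeWeight (G.incidence M) a b = G.shiftVoteA M a b + G.shiftVoteB M b a := by
  have hM := hD.1.1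
  rw [edgeWeight, hD.unpopularA_iff, hD.unpopularB_iff, voteA_eq, voteB_eq]
  simp only [entry_incidence hM]
  congr 1
  · split_ifs with h
    · obtain ⟨b', hb'⟩ := h
      rw [← show (fun b => if (a, b) ∈ M then (1 : ℝ) else 0) = G.entry (G.incidence M) a from
        funext fun b => (entry_incidence hM a b).symm]
      convert rowVote_indicator (Q := fun b => (a, b) ∈ M) (G.rankA a) b hb'
        fun s hs => hM.eq_right hs hb'
      rfl
    · exact (if_neg h).symm
  · split_ifs with h
    · obtain ⟨b', hb'⟩ := h
      convert rowVote_indicator (Q := fun a => (a, b) ∈ M) (G.rankB b) a hb'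
        fun s hs => hM.eq_left hs hb'
      rfl
    · exact (if_neg h).symm

/-- Both sides are the same weight of `N`, because the unpopular vertices are exactly those that `M`
leaves unmatched. -/
theorem IsDominant.wt_add_numUnpopularMatched_eq (hD : G.IsDominant M) (hN : G.IsMatching N) :
    G.wt (G.incidence M) N + G.numUnpopularMatched N =
      (G.votes N M : ℝ) - G.votes M N + numNewlyMatched N M := by
  rw [MarriageInstance.wt_add_numUnpopularMatched_eq _ hN, votes_sub_votes_add_eq hN]
  simp only [hD.edgeWeight_incidence, hD.unpopularA_iff, hD.unpopularB_iff, ite_not]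

theorem IsDominant.incidence_mem_constraint (hD : G.IsDominant M) (i : G.ConstraintIndex) :
    G.incidence M ∈ G.constraint i := by
  have hM := hD.1.1
  rcases i with ⟨a, h⟩ | ⟨b, h⟩ | ⟨e, h⟩ | ⟨e, h⟩ | ⟨N, hN⟩
  · rw [hD.unpopularA_iff, not_not] at h
    obtain ⟨b, hb⟩ := h
    show G.degreeA _ a = 1
    rw [degreeA_eq, sum_eq_single b]
    · simp [entry_incidence hM, hb]
    · intro b' _ hb'
      have : (a, b') ∉ M := fun h => hb' (hM.eq_right h hb)
      simp [entry_incidence hM, this]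
    · simp
  · rw [hD.unpopularB_iff, not_not] at h
    obtain ⟨a, ha⟩ := h
    show G.degreeB _ b = 1
    rw [degreeB_eq, sum_eq_single a]
    · simp [entry_incidence hM, ha]
    · intro a' _ ha'
      have : (a', b) ∉ M := fun h => ha' (hM.eq_left h ha)
      simp [entry_incidence hM, this]
    · simp
  · exact if_neg fun he => h ⟨M, hD, he⟩
  · show (0 : ℝ) ≤ if _ then 1 else 0
    split_ifs <;> norm_num
  · have h1 := hD.wt_add_numUnpopularMatched_eq hN
    have h2 : (G.votes N M : ℝ) + numNewlyMatched N M ≤ G.votes M N := by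
      exact_mod_cast hD.votes_add_numNewlyMatched_le hN
    show G.wt _ N ≤ _
    linarith

end
end MarriageInstance

/-! ### Fractional assignments as consecutive cells of an interval -/

section
open Classical Finset

/-- The total weight of the elements before `t`. -/
noncomputable def cellStart {T : Type*} [Fintype T] (κ : T → ℤ) (w : T → ℝ) (t : T) : ℝ :=
  ∑ s, if κ s < κ t then w s else 0

section
variable {T : Type*} [Fintype T] {κ : T → ℤ} {w : T → ℝ}

theorem cellStart_nonneg (hw : ∀ t, 0 ≤ w t) (t : T) : 0 ≤ cellStart κ w t :=
  sum_nonneg fun s _ => by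
    split_ifs
    exacts [hw s, le_rfl]

theorem cellStart_add_eq (t : T) :
    cellStart κ w t + w t = ∑ s, if κ s < κ t ∨ s = t then w s else 0 := by
  have h1 : w t = ∑ s, if s = t then w s else 0 := by simp
  conv_lhs => rw [h1]
  rw [cellStart, ← sum_add_distrib]
  refine sum_congr rfl fun s _ => ?_
  by_cases h2 : s = t
  · subst h2
    simp
  · simp [h2]

theorem cellStart_add_le (hw : ∀ t, 0 ≤ w t) {t t' : T} (h : κ t < κ t') :
    cellStart κ w t + w t ≤ cellStart κ w t' := by
  rw [cellStart_add_eq]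
  refine sum_le_sum fun s _ => ?_
  by_cases h1 : κ s < κ t ∨ s = t
  · have h2 : κ s < κ t' := h1.elim (fun h1 => h1.trans h) fun h1 => h1 ▸ h
    simp [h1, h2]
  · rw [if_neg h1]
    split_ifs
    exacts [hw s, le_rfl]

theorem cellStart_add_le_sum (hw : ∀ t, 0 ≤ w t) (t : T) :
    cellStart κ w t + w t ≤ ∑ s, w s := by
  rw [cellStart_add_eq]
  refine sum_le_sum fun s _ => ?_
  split_ifs
  exacts [le_rfl, hw s]

/-- The cells of the support tile `[0, ∑ w)` because the keys on the support are distinct. The cell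
sought is the one of least key, among those in the support, that ends beyond `z`. -/
theorem exists_cell (hw : ∀ t, 0 ≤ w t)
    (hκ : ∀ s t, w s ≠ 0 → w t ≠ 0 → κ s = κ t → s = t) {z : ℝ} (hz0 : 0 ≤ z)
    (hz : z < ∑ s, w s) : ∃ t, cellStart κ w t ≤ z ∧ z < cellStart κ w t + w t := by
  have hne : (univ.filter fun t => z < cellStart κ w t + w t ∧ w t ≠ 0).Nonempty := by
    have h1 : (univ.filter fun t => w t ≠ 0).Nonempty := by
      by_contra h
      rw [not_nonempty_iff_eq_empty, filter_eq_empty_iff] at h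
      have : ∑ s, w s = 0 := sum_eq_zero fun s hs => not_not.1 (h hs)
      linarith
    obtain ⟨t, ht, htmax⟩ := exists_max_image _ κ h1
    refine ⟨t, mem_filter.2 ⟨mem_univ t, ?_, (mem_filter.1 ht).2⟩⟩
    rw [cellStart_add_eq]
    refine hz.trans_le (sum_le_sum fun s _ => ?_)
    by_cases hs : w s = 0
    · simp [hs]
    · have h2 := htmax s (mem_filter.2 ⟨mem_univ s, hs⟩)
      have h3 : κ s < κ t ∨ s = t :=
        h2.lt_or_eq.imp_right fun h => hκ s t hs (mem_filter.1 ht).2 h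
      simp [h3]
  obtain ⟨t, ht, htmin⟩ := exists_min_image _ κ hne
  obtain ⟨-, ht1, ht0⟩ := mem_filter.1 ht
  refine ⟨t, ?_, ht1⟩
  by_contra hlt
  push Not at hlt
  have h1 : (univ.filter fun s => κ s < κ t ∧ w s ≠ 0).Nonempty := by
    by_contra h
    rw [not_nonempty_iff_eq_empty, filter_eq_empty_iff] at h
    have : cellStart κ w t = 0 := sum_eq_zero fun s hs => by
      split_ifs with h2
      · exact not_not.1 fun h3 => h hs ⟨h2, h3⟩
      · rfl
    linarith
  obtain ⟨s, hs, hsmax⟩ := exists_max_image _ κ h1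
  obtain ⟨-, hst, hs0⟩ := mem_filter.1 hs
  have h2 : cellStart κ w t ≤ cellStart κ w s + w s := by
    rw [cellStart_add_eq]
    refine sum_le_sum fun s' _ => ?_
    by_cases hs' : w s' = 0
    · simp [hs']
    · by_cases h3 : κ s' < κ t
      · have h4 := hsmax s' (mem_filter.2 ⟨mem_univ _, h3, hs'⟩)
        have h5 : κ s' < κ s ∨ s' = s := h4.lt_or_eq.imp_right fun h => hκ s' s hs' hs0 h
        simp [h3, h5]
      · rw [if_neg h3]
        split_ifs
        exacts [hw s', le_rfl]
  have h3 := htmin s (mem_filter.2 ⟨mem_univ s, hlt.trans_le h2, hs0⟩)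
  omega

theorem sum_add_sum_eq_sum_sub (r : T → ℕ) (t : T) (hr : ∀ s, w s ≠ 0 → r s = r t → s = t) :
    (∑ s, if r s < r t then w s else 0) + (∑ s, if r t < r s then w s else 0) =
      ∑ s, w s - w t := by
  have h1 : w t = ∑ s, if s = t then w s else 0 := by simp
  rw [eq_sub_iff_add_eq]
  conv_lhs => rw [h1]
  rw [← sum_add_distrib, ← sum_add_distrib]
  refine sum_congr rfl fun s _ => ?_
  by_cases hs : w s = 0
  · simp [hs]
  · rcases lt_trichotomy (r s) (r t) with h | h | h
    · have h2 : s ≠ t := by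
        rintro rfl
        exact lt_irrefl _ h
      simp [h, h.not_gt, h2]
    · simp [hr s hs h]
    · have h2 : s ≠ t := by
        rintro rfl
        exact lt_irrefl _ h
      simp [h, h.not_gt, h2]

-- The two sides use opposite layouts, best first here and worst first in the next lemma. When the
-- totals on both sides are 1, the entry then cancels from the sum of the two votes of an edge,
-- leaving twice the difference of the cell starts.
open MarriageInstance in
theorem rowVote_eq_sub (r : T → ℕ) (t : T) (hr : ∀ s, w s ≠ 0 → r s = r t → s = t) :
    rowVote r w t = ∑ s, w s - w t - 2 * cellStart (fun s => (r s : ℤ)) w t := by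
  have h1 := sum_add_sum_eq_sum_sub r t hr
  have h2 : cellStart (fun s => (r s : ℤ)) w t = ∑ s, if r s < r t then w s else 0 := by
    simp [cellStart]
  rw [rowVote, h2]
  linarith

open MarriageInstance in
theorem rowVote_eq_add (r : T → ℕ) (t : T) (hr : ∀ s, w s ≠ 0 → r s = r t → s = t) :
    rowVote r w t = 2 * cellStart (fun s => -(r s : ℤ)) w t + w t - ∑ s, w s := by
  have h1 := sum_add_sum_eq_sum_sub r t hr
  have h2 : cellStart (fun s => -(r s : ℤ)) w t = ∑ s, if r t < r s then w s else 0 := by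
    simp [cellStart]
  rw [rowVote, h2]
  linarith

-- Antisymmetry: each ordered pair of neighbours contributes with both signs, so a fractional
-- assignment ties with itself.
open MarriageInstance in
theorem sum_mul_rowVote (r : T → ℕ) (w : T → ℝ) : ∑ t, w t * rowVote r w t = 0 := by
  simp only [rowVote, mul_sub, sum_sub_distrib, mul_sum]
  rw [sum_comm, sub_eq_zero]
  refine sum_congr rfl fun s _ => sum_congr rfl fun t _ => ?_
  split_ifs
  · ring
  · simp
end

open MeasureTheory in
/-- An interval `[c, d)` inside `[p, p + 1)`, wrapped around `[-1/2, 1/2)`, keeps its length. -/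
theorem integral_wrapped_indicator {p c d : ℝ} (hp : -(1 / 2) ≤ p) (hp' : p ≤ 1 / 2) (hc : p ≤ c)
    (hcd : c ≤ d) (hd : d ≤ p + 1) :
    Integrable (fun θ : ℝ => if c ≤ (if p ≤ θ then θ else θ + 1) ∧
      (if p ≤ θ then θ else θ + 1) < d then (1 : ℝ) else 0)
      (volume.restrict (Set.Ioc (-(1 / 2)) (1 / 2))) ∧
    ∫ θ in Set.Ioc (-(1 / 2)) (1 / 2 : ℝ), (if c ≤ (if p ≤ θ then θ else θ + 1) ∧
      (if p ≤ θ then θ else θ + 1) < d then (1 : ℝ) else 0) = d - c := by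
  let g : ℝ → ℝ := (Set.Ico c d).indicator 1
  have hg : Integrable g volume := by
    refine (integrable_indicator_iff measurableSet_Ico).2 ?_
    exact integrableOn_const (by simp)
  -- Unwrapping: the indicator is that of `[c, d)` plus its translate by 1. The integral over the
  -- circle becomes one over two adjacent unit intervals which together contain `[c, d)`.
  have hf : (fun θ : ℝ => if c ≤ (if p ≤ θ then θ else θ + 1) ∧
      (if p ≤ θ then θ else θ + 1) < d then (1 : ℝ) else 0) = fun θ => g θ + g (θ + 1) := by
    funext θ
    simp only [g, Set.indicator, Set.mem_Ico, Pi.one_apply]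
    by_cases h : p ≤ θ
    · have h1 : ¬ (c ≤ θ + 1 ∧ θ + 1 < d) := fun h1 => by linarith [h1.2]
      simp [h, h1]
    · have h1 : ¬ (c ≤ θ ∧ θ < d) := fun h1 => h (hc.trans h1.1)
      simp [h, h1]
  rw [hf]
  refine ⟨(hg.add (hg.comp_add_right 1)).restrict, ?_⟩
  have hi : ∀ x y : ℝ, IntervalIntegrable g volume x y := fun x y => hg.intervalIntegrable
  rw [integral_add hg.restrict (hg.comp_add_right 1).restrict,
    ← intervalIntegral.integral_of_le (by norm_num), ← intervalIntegral.integral_of_le (by norm_num),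
    intervalIntegral.integral_comp_add_right g 1, show -(1 / 2) + 1 = (1 / 2 : ℝ) by norm_num,
    intervalIntegral.integral_add_adjacent_intervals (hi _ _) (hi _ _),
    intervalIntegral.integral_of_le (by norm_num), ← integral_Ico_eq_integral_Ioc,
    setIntegral_indicator measurableSet_Ico, Set.inter_eq_self_of_subset_right]
  · simp [hcd]
  · exact Set.Ico_subset_Ico (by linarith) (by linarith)
end

/-! ### Rounding a feasible point to dominant matchings -/

namespace MarriageInstance
section
open Classical Finset

variable {A B : Type*} {G : MarriageInstance A B} {x : G.edges → ℝ}

theorem mem_edges_of_entry_ne_zero {a : A} {b : B} (h : G.entry x a b ≠ 0) : (a, b) ∈ G.edges := by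
  by_contra h1
  simp [entry, h1] at h

theorem IsFeasible.injA (a : A) {b : B} (hab : (a, b) ∈ G.edges) (s : B) (hs : G.entry x a s ≠ 0)
    (h : G.rankA a s = G.rankA a b) : s = b :=
  G.rankA_strict a s b (mem_edges_of_entry_ne_zero hs) hab h

theorem IsFeasible.injB (b : B) {a : A} (hab : (a, b) ∈ G.edges) (s : A) (hs : G.entry x s b ≠ 0)
    (h : G.rankB b s = G.rankB b a) : s = a :=
  G.rankB_strict b s a (mem_edges_of_entry_ne_zero hs) hab h

variable [Fintype A] [Fintype B]

/-- The start of the cell of `(a, b)` when the neighbours of `a` are laid out from best to worst. -/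
noncomputable def startA (G : MarriageInstance A B) (x : G.edges → ℝ) (a : A) (b : B) : ℝ :=
  cellStart (fun b => (G.rankA a b : ℤ)) (G.entry x a) b

/-- The start of the cell of `(a, b)` when the neighbours of `b` are laid out from worst to best. -/
noncomputable def startB (G : MarriageInstance A B) (x : G.edges → ℝ) (b : B) (a : A) : ℝ :=
  cellStart (fun a => -(G.rankB b a : ℤ)) (fun a => G.entry x a b) a

/-- The feasible points together with the properties of their entries. -/
structure IsFeasible (G : MarriageInstance A B) (x : G.edges → ℝ) : Prop where
  nonneg : ∀ a b, 0 ≤ G.entry x a b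
  popularA : ∀ a b, G.entry x a b ≠ 0 → ¬ G.UnpopularA a
  popularB : ∀ a b, G.entry x a b ≠ 0 → ¬ G.UnpopularB b
  sumA : ∀ a, ¬ G.UnpopularA a → ∑ b, G.entry x a b = 1
  sumB : ∀ b, ¬ G.UnpopularB b → ∑ a, G.entry x a b = 1
  wt_le : ∀ N, G.IsMatching N → G.wt x N ≤ -(G.numUnpopularMatched N : ℝ)

/-- Dominant edges matter for sufficiency only because the support must avoid U: both endpoints of a
dominant edge are matched in some dominant matching, so they are not unpopular. -/
theorem isFeasible_of_mem (hx : x ∈ ⋂ i, G.constraint i) : G.IsFeasible x := by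
  rw [Set.mem_iInter] at hx
  have h1 : ∀ a b, G.entry x a b ≠ 0 → G.IsDominantEdge (a, b) := by
    intro a b h
    by_contra h2
    have hE := mem_edges_of_entry_ne_zero h
    have h3 : x ⟨(a, b), hE⟩ = 0 := hx (.zero ⟨(a, b), hE⟩ h2)
    exact h (by simpa [entry, hE] using h3)
  refine ⟨fun a b => ?_, fun a b h hU => ?_, fun a b h hU => ?_, fun a h => ?_, fun b h => ?_,
    fun N hN => hx (.matching N hN)⟩
  · by_cases h : G.entry x a b = 0
    · exact h.ge
    · have hE := mem_edges_of_entry_ne_zero h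
      have h3 : 0 ≤ x ⟨(a, b), hE⟩ := hx (.nonneg ⟨(a, b), hE⟩ (h1 a b h))
      simpa [entry, hE] using h3
  · obtain ⟨M, hM, he⟩ := h1 a b h
    exact (hM.unpopularA_iff a).1 hU ⟨b, he⟩
  · obtain ⟨M, hM, he⟩ := h1 a b h
    exact (hM.unpopularB_iff b).1 hU ⟨a, he⟩
  · rw [← degreeA_eq]
    exact hx (.vertexA a h)
  · rw [← degreeB_eq]
    exact hx (.vertexB b h)

namespace IsFeasible

theorem voteA_eq_sub (hx : G.IsFeasible x) {a : A} {b : B} (hab : (a, b) ∈ G.edges)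
    (ha : ¬ G.UnpopularA a) :
    G.voteA x a b = 1 - G.entry x a b - 2 * G.startA x a b := by
  rw [voteA_eq, rowVote_eq_sub (G.rankA a) b (injA a hab), hx.sumA a ha]
  rfl

theorem voteB_eq_add (hx : G.IsFeasible x) {a : A} {b : B} (hab : (a, b) ∈ G.edges)
    (hb : ¬ G.UnpopularB b) :
    G.voteB x b a = 2 * G.startB x b a + G.entry x a b - 1 := by
  rw [voteB_eq, rowVote_eq_add (G.rankB b) a (injB b hab), hx.sumB b hb]
  rfl

theorem startA_nonneg (hx : G.IsFeasible x) (a : A) (b : B) : 0 ≤ G.startA x a b :=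
  cellStart_nonneg (hx.nonneg a) b

theorem startB_nonneg (hx : G.IsFeasible x) (a : A) (b : B) : 0 ≤ G.startB x b a :=
  cellStart_nonneg (fun a => hx.nonneg a b) a

theorem startA_add_le_one (hx : G.IsFeasible x) {a : A} (ha : ¬ G.UnpopularA a) (b : B) :
    G.startA x a b + G.entry x a b ≤ 1 :=
  (cellStart_add_le_sum (hx.nonneg a) b).trans (hx.sumA a ha).le

theorem startB_add_le_one (hx : G.IsFeasible x) {b : B} (hb : ¬ G.UnpopularB b) (a : A) :
    G.startB x b a + G.entry x a b ≤ 1 :=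
  (cellStart_add_le_sum (w := fun a => G.entry x a b) (fun a => hx.nonneg a b) a).trans
    (hx.sumB b hb).le

theorem startA_add_le (hx : G.IsFeasible x) {a : A} {b b' : B} (h : G.rankA a b < G.rankA a b') :
    G.startA x a b + G.entry x a b ≤ G.startA x a b' :=
  cellStart_add_le (hx.nonneg a) (by simpa using h)

theorem startB_add_le (hx : G.IsFeasible x) {b : B} {a a' : A} (h : G.rankB b a' < G.rankB b a) :
    G.startB x b a + G.entry x a b ≤ G.startB x b a' :=
  cellStart_add_le (w := fun a => G.entry x a b) (fun a => hx.nonneg a b) (by simpa using h)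

theorem exists_cellA (hx : G.IsFeasible x) {a : A} (ha : ¬ G.UnpopularA a) {z : ℝ} (hz0 : 0 ≤ z)
    (hz : z < 1) : ∃ b, G.startA x a b ≤ z ∧ z < G.startA x a b + G.entry x a b := by
  refine exists_cell (hx.nonneg a) (fun s t hs ht h => ?_) hz0 ((hx.sumA a ha).symm ▸ hz)
  exact injA a (mem_edges_of_entry_ne_zero ht) s hs (by exact_mod_cast h)

theorem exists_cellB (hx : G.IsFeasible x) {b : B} (hb : ¬ G.UnpopularB b) {z : ℝ} (hz0 : 0 ≤ z)
    (hz : z < 1) : ∃ a, G.startB x b a ≤ z ∧ z < G.startB x b a + G.entry x a b := by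
  refine exists_cell (w := fun a => G.entry x a b) (fun a => hx.nonneg a b)
    (fun s t hs ht h => ?_) hz0 ((hx.sumB b hb).symm ▸ hz)
  exact injB b (mem_edges_of_entry_ne_zero ht) s hs (by exact_mod_cast neg_injective h)

theorem sum_entry_mul_edgeWeight (hx : G.IsFeasible x) :
    ∑ a, ∑ b, G.entry x a b * G.edgeWeight x a b = 0 := by
  have h1 : ∀ a b, G.entry x a b * G.edgeWeight x a b =
      G.entry x a b * G.voteA x a b + G.entry x a b * G.voteB x b a := by
    intro a b
    by_cases h : G.entry x a b = 0
    · simp [h]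
    · simp only [edgeWeight, hx.popularA a b h, hx.popularB a b h, if_false]
      ring
  simp only [h1, sum_add_distrib, voteA_eq, voteB_eq]
  rw [sum_comm (f := fun a b => G.entry x a b * rowVote (G.rankB b) (fun a => G.entry x a b) a)]
  rw [sum_eq_zero fun a _ => sum_mul_rowVote (G.rankA a) (G.entry x a),
    sum_eq_zero fun b _ => sum_mul_rowVote (G.rankB b) (fun a => G.entry x a b), add_zero]

/-- The matching constraints bound the maximum-weight matching by zero. The point `x` is a
fractional matching of weight zero that saturates the popular vertices, so the dual solution is
optimal: complementary slackness makes the support tight and the potentials vanish on U. -/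
theorem exists_dual (hx : G.IsFeasible x) : ∃ (α : A → ℝ) (β : B → ℝ),
    (∀ a b, (a, b) ∈ G.edges → G.edgeWeight x a b ≤ α a + β b) ∧
    (∀ a b, G.entry x a b ≠ 0 → G.edgeWeight x a b = α a + β b) ∧
    (∀ a, ¬ G.UnpopularA a → -1 ≤ α a) ∧ (∀ b, ¬ G.UnpopularB b → -1 ≤ β b) ∧
    (∀ a, G.UnpopularA a → α a = 0) ∧ (∀ b, G.UnpopularB b → β b = 0) := by
  obtain ⟨α, β, hcov, hα, hβ, hsum⟩ := exists_dual_of_matching_weights G.edges (G.edgeWeight x)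
    (fun a => if G.UnpopularA a then 0 else -1) (fun b => if G.UnpopularB b then 0 else -1)
    fun N h1 h2 h3 => by
      rw [← wt_add_numUnpopularMatched_eq x ⟨h1, h2, h3⟩]
      linarith [hx.wt_le N ⟨h1, h2, h3⟩]
  have hαU : ∀ a, G.UnpopularA a → 0 ≤ α a := fun a ha => by simpa [ha] using hα a
  have hβU : ∀ b, G.UnpopularB b → 0 ≤ β b := fun b hb => by simpa [hb] using hβ b
  have hterm : ∀ a b, 0 ≤ G.entry x a b * (α a + β b - G.edgeWeight x a b) := by
    intro a b
    by_cases h : G.entry x a b = 0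
    · simp [h]
    · have := hcov a b (mem_edges_of_entry_ne_zero h)
      exact mul_nonneg (hx.nonneg a b) (by linarith)
  have hrowA : ∀ a, ∑ b, G.entry x a b * α a = if G.UnpopularA a then 0 else α a := by
    intro a
    rw [← sum_mul]
    split_ifs with h
    · rw [sum_eq_zero fun b _ => not_not.1 fun h' => hx.popularA a b h' h, zero_mul]
    · rw [hx.sumA a h, one_mul]
  have hrowB : ∀ b, ∑ a, G.entry x a b * β b = if G.UnpopularB b then 0 else β b := by
    intro b
    rw [← sum_mul]
    split_ifs with h
    · rw [sum_eq_zero fun a _ => not_not.1 fun h' => hx.popularB a b h' h, zero_mul]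
    · rw [hx.sumB b h, one_mul]
  -- The total slack on the support equals the popular part of the dual value. The unpopular part is
  -- nonnegative and the whole is at most zero, so every slack and every unpopular potential is
  -- zero.
  have htotal : ∑ a, ∑ b, G.entry x a b * (α a + β b - G.edgeWeight x a b) =
      (∑ a, if G.UnpopularA a then 0 else α a) + ∑ b, if G.UnpopularB b then 0 else β b := by
    simp only [mul_sub, mul_add, sum_sub_distrib, sum_add_distrib, hx.sum_entry_mul_edgeWeight]
    rw [sum_comm (f := fun a b => G.entry x a b * β b)]
    simp only [hrowA, hrowB, sub_zero]
  have hsplitA : ∑ a, α a = (∑ a, if G.UnpopularA a then α a else 0) +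
      ∑ a, if G.UnpopularA a then 0 else α a := by
    rw [← sum_add_distrib]
    exact sum_congr rfl fun a _ => by split_ifs <;> simp
  have hsplitB : ∑ b, β b = (∑ b, if G.UnpopularB b then β b else 0) +
      ∑ b, if G.UnpopularB b then 0 else β b := by
    rw [← sum_add_distrib]
    exact sum_congr rfl fun a _ => by split_ifs <;> simp
  have hUA : ∀ a ∈ univ, 0 ≤ if G.UnpopularA a then α a else 0 := fun a _ => by
    split_ifs with h
    exacts [hαU a h, le_rfl]
  have hUB : ∀ b ∈ univ, 0 ≤ if G.UnpopularB b then β b else 0 := fun a _ => by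
    split_ifs with h
    exacts [hβU a h, le_rfl]
  have h1 := sum_nonneg hUA
  have h2 := sum_nonneg hUB
  have h3 : 0 ≤ ∑ a, ∑ b, G.entry x a b * (α a + β b - G.edgeWeight x a b) :=
    sum_nonneg fun a _ => sum_nonneg fun b _ => hterm a b
  refine ⟨α, β, hcov, ?_, fun a ha => by simpa [ha] using hα a,
    fun b hb => by simpa [hb] using hβ b, ?_, ?_⟩
  · intro a b h
    have h4 : ∑ a, ∑ b, G.entry x a b * (α a + β b - G.edgeWeight x a b) = 0 := by linarith
    have h5 := (sum_eq_zero_iff_of_nonneg fun a _ => sum_nonneg fun b _ => hterm a b).1 h4 a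
      (mem_univ a)
    have h6 := (sum_eq_zero_iff_of_nonneg fun b _ => hterm a b).1 h5 b (mem_univ b)
    have := (mul_eq_zero.1 h6).resolve_left h
    linarith
  · intro a ha
    have := (sum_eq_zero_iff_of_nonneg hUA).1 (by linarith) a (mem_univ a)
    simpa [ha] using this
  · intro b hb
    have := (sum_eq_zero_iff_of_nonneg hUB).1 (by linarith) b (mem_univ b)
    simpa [hb] using this

/-- Shifts of the cells of all vertices by which the two cells of every edge in the support
coincide. -/
theorem exists_shifts (hx : G.IsFeasible x) : ∃ (p : A → ℝ) (q : B → ℝ),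
    (∀ a, ¬ G.UnpopularA a → -(1 / 2) ≤ p a ∧ p a ≤ 1 / 2) ∧
    (∀ b, ¬ G.UnpopularB b → -(1 / 2) ≤ q b ∧ q b ≤ 1 / 2) ∧
    (∀ a b, G.entry x a b ≠ 0 → p a + G.startA x a b = q b + G.startB x b a) ∧
    (∀ a b, (a, b) ∈ G.edges → ¬ G.UnpopularA a → ¬ G.UnpopularB b →
      q b + G.startB x b a ≤ p a + G.startA x a b) ∧
    (∀ a b, (a, b) ∈ G.edges → G.UnpopularA a → ¬ G.UnpopularB b ∧ q b = -(1 / 2) ∧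
      G.startB x b a = 0 ∧ G.entry x a b = 0) ∧
    (∀ a b, (a, b) ∈ G.edges → G.UnpopularB b → ¬ G.UnpopularA a ∧ p a = 1 / 2 ∧
      G.startA x a b = 1) := by
  obtain ⟨α, β, hcov, htight, hα, hβ, hα0, hβ0⟩ := hx.exists_dual
  have hw : ∀ a b, (a, b) ∈ G.edges → ¬ G.UnpopularA a → ¬ G.UnpopularB b →
      G.edgeWeight x a b = 2 * (G.startB x b a - G.startA x a b) := by
    intro a b hab ha hb
    rw [edgeWeight, if_neg ha, if_neg hb, hx.voteA_eq_sub hab ha, hx.voteB_eq_add hab hb]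
    ring
  have heq : ∀ a b, G.entry x a b ≠ 0 →
      α a / 2 + G.startA x a b = -(β b / 2) + G.startB x b a := by
    intro a b h
    have h1 := htight a b h
    rw [hw a b (mem_edges_of_entry_ne_zero h) (hx.popularA a b h) (hx.popularB a b h)] at h1
    linarith
  have hα1 : ∀ a, ¬ G.UnpopularA a → α a ≤ 1 := by
    intro a ha
    by_contra h
    push Not at h
    -- The chosen `z` is near enough to the worst end of the layout of `a` that the translated cell
    -- at `z` would end beyond 3/2. But it coincides with a translated cell of `b`, which ends at
    -- most 1 after a start that is at most 1/2.
    obtain ⟨b, hb, hb'⟩ := hx.exists_cellA ha (z := max 0 (1 - (α a - 1) / 2)) (le_max_left _ _)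
      (max_lt one_pos (by linarith))
    have h0 : G.entry x a b ≠ 0 := fun h0 => by linarith
    have h1 := hx.startB_add_le_one (hx.popularB a b h0) a
    have h2 := hβ b (hx.popularB a b h0)
    have h3 := heq a b h0
    have h4 := le_max_right 0 (1 - (α a - 1) / 2)
    linarith
  have hβ1 : ∀ b, ¬ G.UnpopularB b → β b ≤ 1 := by
    intro b hb
    obtain ⟨a, ha, ha'⟩ := hx.exists_cellB hb le_rfl one_pos
    have h0 : G.entry x a b ≠ 0 := fun h0 => by linarith
    have h2 := hα a (hx.popularA a b h0)
    have h3 := heq a b h0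
    have h4 := hx.startA_nonneg a b
    linarith
  refine ⟨fun a => α a / 2, fun b => -(β b / 2),
    fun a ha => ⟨by linarith [hα a ha], by linarith [hα1 a ha]⟩,
    fun b hb => ⟨by linarith [hβ1 b hb], by linarith [hβ b hb]⟩, heq, ?_, ?_, ?_⟩
  · intro a b hab ha hb
    have h1 := hcov a b hab
    rw [hw a b hab ha hb] at h1
    linarith
  -- An unpopular endpoint contributes 2, so the covering inequality at such an edge holds only with
  -- equality in the bounds on the other endpoint: its shift is extreme and the cell is at the end
  -- of the layout. Two unpopular endpoints would give `4 ≤ 0`.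
  · intro a b hab ha
    have h1 := hcov a b hab
    rw [edgeWeight, if_pos ha, hα0 a ha] at h1
    by_cases hb : G.UnpopularB b
    · rw [if_pos hb, hβ0 b hb] at h1
      norm_num at h1
    · rw [if_neg hb, hx.voteB_eq_add hab hb] at h1
      have h2 := hβ1 b hb
      have h3 := hx.startB_nonneg a b
      have h4 := hx.nonneg a b
      refine ⟨hb, ?_, ?_, ?_⟩ <;> linarith
  · intro a b hab hb
    have h1 := hcov a b hab
    rw [edgeWeight, if_pos hb, hβ0 b hb] at h1
    by_cases ha : G.UnpopularA a
    · rw [if_pos ha, hα0 a ha] at h1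
      norm_num at h1
    · rw [if_neg ha, hx.voteA_eq_sub hab ha] at h1
      have h2 := hα1 a ha
      have h3 := hx.startA_add_le_one ha b
      have h4 := hx.nonneg a b
      refine ⟨ha, ?_, ?_⟩ <;> linarith

end IsFeasible

/-- The edges whose cell contains the point `θ` of the circle. -/
noncomputable def roundAt (G : MarriageInstance A B) (x : G.edges → ℝ) (p : A → ℝ) (θ : ℝ) :
    Finset (A × B) :=
  G.edges.filter fun e =>
    p e.1 + G.startA x e.1 e.2 ≤ (if p e.1 ≤ θ then θ else θ + 1) ∧
    (if p e.1 ≤ θ then θ else θ + 1) < p e.1 + G.startA x e.1 e.2 + G.entry x e.1 e.2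

/-- Each popular vertex reads the circle at `θ` through its translated interval and takes the cell
it finds. Cells of support edges coincide for both endpoints, so the choices agree and match exactly
the popular vertices. -/
theorem IsFeasible.isDominant_roundAt (hx : G.IsFeasible x) (p : A → ℝ) (q : B → ℝ)
    (hp : ∀ a, ¬ G.UnpopularA a → -(1 / 2) ≤ p a ∧ p a ≤ 1 / 2)
    (hq : ∀ b, ¬ G.UnpopularB b → -(1 / 2) ≤ q b ∧ q b ≤ 1 / 2)
    (heq : ∀ a b, G.entry x a b ≠ 0 → p a + G.startA x a b = q b + G.startB x b a)
    (hcov : ∀ a b, (a, b) ∈ G.edges → ¬ G.UnpopularA a → ¬ G.UnpopularB b →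
      q b + G.startB x b a ≤ p a + G.startA x a b)
    (hUA : ∀ a b, (a, b) ∈ G.edges → G.UnpopularA a → ¬ G.UnpopularB b ∧ q b = -(1 / 2) ∧
      G.startB x b a = 0 ∧ G.entry x a b = 0)
    (hUB : ∀ a b, (a, b) ∈ G.edges → G.UnpopularB b → ¬ G.UnpopularA a ∧ p a = 1 / 2 ∧
      G.startA x a b = 1)
    {θ : ℝ} (hθ : -(1 / 2) ≤ θ) (hθ' : θ < 1 / 2) : G.IsDominant (G.roundAt x p θ) := by
  set M := G.roundAt x p θ with hM
  let zA : A → ℝ := fun a => if p a ≤ θ then θ else θ + 1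
  let zB : B → ℝ := fun b => if q b ≤ θ then θ else θ + 1
  have hzA : ∀ a, ¬ G.UnpopularA a → p a ≤ zA a ∧ zA a < p a + 1 := by
    intro a ha
    have := hp a ha
    simp only [zA]
    split_ifs <;> constructor <;> linarith
  have hzB : ∀ b, ¬ G.UnpopularB b → q b ≤ zB b ∧ zB b < q b + 1 := by
    intro b hb
    have := hq b hb
    simp only [zB]
    split_ifs <;> constructor <;> linarith
  have hmem : ∀ a b, (a, b) ∈ M ↔ p a + G.startA x a b ≤ zA a ∧
      zA a < p a + G.startA x a b + G.entry x a b := by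
    intro a b
    simp only [hM, roundAt, mem_filter, zA]
    refine ⟨fun h => h.2, fun h => ⟨mem_edges_of_entry_ne_zero (x := x) fun h0 => ?_, h⟩⟩
    linarith
  have hne : ∀ a b, (a, b) ∈ M → G.entry x a b ≠ 0 := by
    intro a b h h0
    have := (hmem a b).1 h
    linarith
  have hz : ∀ a b, (a, b) ∈ M → zA a = zB b := by
    intro a b h
    have h0 := hne a b h
    have h1 := (hmem a b).1 h
    have h2 := heq a b h0
    have h3 := hx.startB_nonneg a b
    have h4 := hx.startB_add_le_one (hx.popularB a b h0) a
    simp only [zA, zB] at h1 ⊢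
    split_ifs at h1 ⊢ <;> linarith
  have hmemB : ∀ a b, (a, b) ∈ M → q b + G.startB x b a ≤ zB b ∧
      zB b < q b + G.startB x b a + G.entry x a b := by
    intro a b h
    have h1 := (hmem a b).1 h
    rwa [hz a b h, heq a b (hne a b h)] at h1
  have huniqA : ∀ a b b', (a, b) ∈ M → (a, b') ∈ M → b = b' := by
    intro a b b' h h'
    have h1 := (hmem _ _).1 h
    have h2 := (hmem _ _).1 h'
    rcases lt_trichotomy (G.rankA a b) (G.rankA a b') with h3 | h3 | h3
    · linarith [hx.startA_add_le h3]
    · exact IsFeasible.injA a (mem_edges_of_entry_ne_zero (hne _ _ h')) b (hne _ _ h) h3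
    · linarith [hx.startA_add_le h3]
  have huniqB : ∀ b a a', (a, b) ∈ M → (a', b) ∈ M → a = a' := by
    intro b a a' h h'
    have h1 := hmemB _ _ h
    have h2 := hmemB _ _ h'
    rcases lt_trichotomy (G.rankB b a) (G.rankB b a') with h3 | h3 | h3
    · linarith [hx.startB_add_le h3]
    · exact IsFeasible.injB b (mem_edges_of_entry_ne_zero (hne _ _ h')) a (hne _ _ h) h3
    · linarith [hx.startB_add_le h3]
  have hmatch : G.IsMatching M := by
    refine ⟨filter_subset _ _, ?_, ?_⟩
    · rintro ⟨a, b⟩ he ⟨a', b'⟩ hf (rfl : a = a')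
      rw [huniqA a b b' he hf]
    · rintro ⟨a, b⟩ he ⟨a', b'⟩ hf (rfl : b = b')
      rw [huniqB b a a' he hf]
  have hMA : ∀ a, ¬ G.UnpopularA a ↔ MatchedA M a := by
    intro a
    refine ⟨fun ha => ?_, fun ⟨b, hb⟩ => hx.popularA a b (hne a b hb)⟩
    have h1 := hzA a ha
    obtain ⟨b, hb, hb'⟩ := hx.exists_cellA ha (z := zA a - p a) (by linarith) (by linarith)
    exact ⟨b, (hmem a b).2 ⟨by linarith, by linarith⟩⟩
  have hMB : ∀ b, ¬ G.UnpopularB b ↔ MatchedB M b := by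
    intro b
    refine ⟨fun hb => ?_, fun ⟨a, ha⟩ => hx.popularB a b (hne a b ha)⟩
    have h1 := hzB b hb
    obtain ⟨a, ha, ha'⟩ := hx.exists_cellB hb (z := zB b - q b) (by linarith) (by linarith)
    have h0 : G.entry x a b ≠ 0 := fun h0 => by linarith
    have h2 := hzA a (hx.popularA a b h0)
    have h3 := heq a b h0
    have h4 := hx.startA_nonneg a b
    have h5 := hx.startA_add_le_one (hx.popularA a b h0) b
    have h6 : zA a = zB b := by
      simp only [zA, zB] at h1 ha ha' h2 ⊢
      split_ifs at h1 ha ha' h2 ⊢ <;> linarith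
    exact ⟨a, (hmem a b).2 ⟨by linarith, by linarith⟩⟩
  -- For a popular vertex of `A` the potential is -1 if it reads at `θ` and 1 if it reads at `θ +
  -- 1`; the signs are opposite in `B`. Thus the sum over an edge outside U is twice the difference
  -- of the two reading points.
  refine isDominant_of_potential hmatch
    (fun a => if G.UnpopularA a then 0 else 2 * (zA a - θ) - 1)
    (fun b => if G.UnpopularB b then 0 else 1 - 2 * (zB b - θ)) ?_ ?_ ?_ ?_ ?_ ?_
  · intro a ha
    exact if_pos (not_not.1 (mt (hMA a).1 ha))
  · intro b hb
    exact if_pos (not_not.1 (mt (hMB b).1 hb))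
  · intro a ha
    rw [if_neg ((hMA a).2 ha)]
    simp only [zA]
    split_ifs <;> linarith
  · intro b hb
    rw [if_neg ((hMB b).2 hb)]
    simp only [zB]
    split_ifs <;> linarith
  · intro a b h
    rw [if_neg ((hMA a).2 ⟨b, h⟩), if_neg ((hMB b).2 ⟨a, h⟩), hz a b h]
    ring
  · intro a b hab
    by_cases ha : G.UnpopularA a
    · obtain ⟨hb, hqb, hs, h0⟩ := hUA a b hab ha
      obtain ⟨a', ha'⟩ := (hMB b).1 hb
      have hzb : zB b = θ := if_pos (by linarith)
      have h1 := hmemB a' b ha'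
      have h2 : G.rankB b a' < G.rankB b a := by
        rcases lt_trichotomy (G.rankB b a) (G.rankB b a') with h3 | h3 | h3
        · linarith [hx.startB_add_le h3, hx.nonneg a' b]
        · have := IsFeasible.injB b hab a' (hne _ _ ha') h3.symm
          subst this
          exact absurd h0 (hne _ _ ha')
        · exact h3
      rw [if_pos ha, if_neg hb, hzb,
        show G.shiftVoteA M a b = 2 from if_neg fun h => (hMA a).2 h ha, shiftVoteB, shiftVote_of_mem _ a ha'
          fun s hs => huniqB b s a' hs ha', if_pos h2, if_neg h2.not_gt]
      norm_num
    · by_cases hb : G.UnpopularB b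
      · obtain ⟨-, hpa, hs⟩ := hUB a b hab hb
        obtain ⟨b', hb'⟩ := (hMA a).1 ha
        have hza : zA a = θ + 1 := if_neg (by linarith)
        have h1 := (hmem a b').1 hb'
        have h2 : G.rankA a b' < G.rankA a b := by
          rcases lt_trichotomy (G.rankA a b) (G.rankA a b') with h3 | h3 | h3
          · linarith [hx.startA_add_le h3, hx.nonneg a b]
          · have := IsFeasible.injA a hab b' (hne _ _ hb') h3.symm
            subst this
            linarith
          · exact h3
        rw [if_neg ha, if_pos hb, hza,
          show G.shiftVoteB M b a = 2 from if_neg fun h => (hMB b).2 h hb, shiftVoteA, shiftVote_of_mem _ b hb'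
            fun s hs => huniqA a s b' hs hb', if_pos h2, if_neg h2.not_gt]
        linarith
      · obtain ⟨b', hb'⟩ := (hMA a).1 ha
        obtain ⟨a', ha'⟩ := (hMB b).1 hb
        have h1 := (hmem a b').1 hb'
        have h2 := hmemB a' b ha'
        have h3 := hcov a b hab ha hb
        have h4 := hzA a ha
        have h5 := hzB b hb
        have h6 := hx.nonneg a b
        have h7 := hx.startA_add_le_one ha b
        have h8 := hx.startB_nonneg a b
        have hA0 : G.rankA a b = G.rankA a b' → (a, b) ∈ M := fun h =>
          IsFeasible.injA a hab b' (hne _ _ hb') h.symm ▸ hb'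
        have hB0 : G.rankB b a = G.rankB b a' → (a, b) ∈ M := fun h =>
          IsFeasible.injB b hab a' (hne _ _ ha') h.symm ▸ ha'
        rw [if_neg ha, if_neg hb, shiftVoteA, shiftVote_of_mem _ b hb'
            fun s hs => huniqA a s b' hs hb', shiftVoteB, shiftVote_of_mem _ a ha'
            fun s hs => huniqB b s a' hs ha']
        by_cases hin : (a, b) ∈ M
        · have e1 := huniqA a b b' hin hb'
          have e2 := huniqB b a a' hin ha'
          subst e1 e2
          simp only [lt_irrefl, if_false]
          rw [hz a b hin]
          linarith
        · have hz3 : zA a - zB b = 1 ∨ (zA a = zB b) ∨ (zA a = θ ∧ zB b = θ + 1) := by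
            simp only [zA, zB]
            split_ifs <;> simp
          rcases lt_trichotomy (G.rankA a b) (G.rankA a b') with r1 | r1 | r1
          · have s1 := hx.startA_add_le r1
            rcases lt_trichotomy (G.rankB b a) (G.rankB b a') with r2 | r2 | r2
            · have s2 := hx.startB_add_le r2
              simp only [r1, r2, r1.not_gt, r2.not_gt, if_true, if_false]
              rcases hz3 with h | h | ⟨h, h'⟩ <;> linarith
            · exact absurd (hB0 r2) hin
            · simp only [r1, r2, r1.not_gt, r2.not_gt, if_true, if_false]
              rcases hz3 with h | h | ⟨h, h'⟩ <;> linarith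
          · exact absurd (hA0 r1) hin
          · have s1 := hx.startA_add_le r1
            rcases lt_trichotomy (G.rankB b a) (G.rankB b a') with r2 | r2 | r2
            · have s2 := hx.startB_add_le r2
              simp only [r1, r2, r1.not_gt, r2.not_gt, if_true, if_false]
              rcases hz3 with h | h | ⟨h, h'⟩ <;> linarith
            · exact absurd (hB0 r2) hin
            · simp only [r1, r2, r1.not_gt, r2.not_gt, if_true, if_false]
              rcases hz3 with h | h | ⟨h, h'⟩ <;> linarith

theorem finite_dominant_incidence (G : MarriageInstance A B) :
    {x | ∃ M, G.IsDominant M ∧ x = G.incidence M}.Finite := by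
  refine (Set.finite_range G.incidence).subset ?_
  rintro x ⟨M, -, rfl⟩
  exact ⟨M, rfl⟩

-- For uniform `θ` an edge is picked with probability equal to the length of its cell, so `x` is the
-- mean of incidence vectors of dominant matchings. The hull of finitely many points is closed and
-- convex, hence contains the mean.
open MeasureTheory in
theorem IsFeasible.mem_dominantPolytope (hx : G.IsFeasible x) : x ∈ G.dominantPolytope := by
  obtain ⟨p, q, hp, hq, heq, hcov, hUA, hUB⟩ := hx.exists_shifts
  let μ : Measure ℝ := volume.restrict (Set.Ioc (-(1 / 2)) (1 / 2))
  have hμ : IsProbabilityMeasure μ := ⟨by simp [μ]; norm_num⟩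
  have key : ∀ e : G.edges, Integrable (fun θ => G.incidence (G.roundAt x p θ) e) μ ∧
      ∫ θ, G.incidence (G.roundAt x p θ) e ∂μ = x e := by
    rintro ⟨⟨a, b⟩, hab⟩
    have hxe : x ⟨(a, b), hab⟩ = G.entry x a b := by simp [entry, hab]
    by_cases h0 : G.entry x a b = 0
    · have h1 : ∀ θ, G.incidence (G.roundAt x p θ) ⟨(a, b), hab⟩ = 0 := by
        intro θ
        refine if_neg fun h => ?_
        have := (mem_filter.1 h).2
        linarith
      simp [h1, hxe, h0]
    · have ha := hx.popularA a b h0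
      have h1 := integral_wrapped_indicator (p := p a) (c := p a + G.startA x a b)
        (d := p a + G.startA x a b + G.entry x a b) (hp a ha).1 (hp a ha).2
        (by linarith [hx.startA_nonneg a b]) (by linarith [hx.nonneg a b])
        (by linarith [hx.startA_add_le_one ha b])
      rw [hxe]
      have h2 : (fun θ => G.incidence (G.roundAt x p θ) ⟨(a, b), hab⟩) = fun θ : ℝ =>
          if p a + G.startA x a b ≤ (if p a ≤ θ then θ else θ + 1) ∧
            (if p a ≤ θ then θ else θ + 1) < p a + G.startA x a b + G.entry x a b
          then (1 : ℝ) else 0 := by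
        funext θ
        simp [incidence, roundAt, hab]
      rw [h2]
      exact ⟨h1.1, h1.2.trans (by ring)⟩
  have h1 : x = ∫ θ, G.incidence (G.roundAt x p θ) ∂μ := by
    funext e
    rw [eval_integral fun e => (key e).1, (key e).2]
  rw [h1]
  refine (convex_convexHull ℝ _).integral_mem
    (G.finite_dominant_incidence.isClosed_convexHull ℝ) ?_ (Integrable.of_eval fun e => (key e).1)
  -- The circle is `[-1/2, 1/2)` in the rounding but `(-1/2, 1/2]` in the measure; the endpoint is a
  -- null set.
  have h2 : ∀ᵐ θ ∂μ, θ ≠ 1 / 2 :=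
    ae_restrict_of_ae (by simp [ae_iff])
  filter_upwards [ae_restrict_mem measurableSet_Ioc, h2] with θ hθ hθ'
  exact subset_convexHull ℝ _ ⟨_, hx.isDominant_roundAt p q hp hq heq hcov hUA hUB hθ.1.le
    (lt_of_le_of_ne hθ.2 hθ'), rfl⟩

end
end MarriageInstance

/-! ### Linearity and number of the constraints -/

section
open Classical Finset

/-- A real-valued affine function on `ℝ^ι`. -/
def IsAffineFun {ι : Type*} (f : (ι → ℝ) → ℝ) : Prop :=
  ∃ (L : (ι → ℝ) →ₗ[ℝ] ℝ) (c : ℝ), ∀ x, f x = L x + c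

namespace IsAffineFun
variable {ι : Type*} {f g : (ι → ℝ) → ℝ}

theorem const (c : ℝ) : IsAffineFun fun _ : ι → ℝ => c := ⟨0, c, fun x => by simp⟩

theorem eval (i : ι) : IsAffineFun fun x : ι → ℝ => x i := ⟨LinearMap.proj i, 0, fun x => by simp⟩

theorem add (hf : IsAffineFun f) (hg : IsAffineFun g) : IsAffineFun fun x => f x + g x := by
  obtain ⟨L, c, h⟩ := hf
  obtain ⟨L', c', h'⟩ := hg
  refine ⟨L + L', c + c', fun x => ?_⟩
  simp only [h, h', LinearMap.add_apply]
  ring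

theorem sub (hf : IsAffineFun f) (hg : IsAffineFun g) : IsAffineFun fun x => f x - g x := by
  obtain ⟨L, c, h⟩ := hf
  obtain ⟨L', c', h'⟩ := hg
  refine ⟨L - L', c - c', fun x => ?_⟩
  simp only [h, h', LinearMap.sub_apply]
  ring

theorem sum {κ : Type*} (s : Finset κ) {f : κ → (ι → ℝ) → ℝ} (hf : ∀ k, IsAffineFun (f k)) :
    IsAffineFun fun x => ∑ k ∈ s, f k x := by
  induction s using Finset.induction_on with
  | empty => simpa using const 0
  | insert k s hk ih =>
    simp only [sum_insert hk]
    exact (hf k).add ih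

theorem ite (p : Prop) [Decidable p] (hf : IsAffineFun f) (hg : IsAffineFun g) :
    IsAffineFun fun x => if p then f x else g x := by
  by_cases h : p <;> simpa [h]

variable [Fintype ι]

theorem isLinearConstraint_le (hf : IsAffineFun f) (q : ℝ) : IsLinearConstraint {x | f x ≤ q} := by
  obtain ⟨L, c, h⟩ := hf
  refine ⟨fun i => L (fun j => if i = j then 1 else 0), q - c, .inl ?_⟩
  ext x
  have h1 := L.pi_apply_eq_sum_univ x
  simp only [smul_eq_mul] at h1
  show f x ≤ q ↔ (∑ i, _ : ℝ) ≤ _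
  rw [h, h1, le_sub_iff_add_le]
  simp only [mul_comm]

theorem isLinearConstraint_eq (hf : IsAffineFun f) (q : ℝ) : IsLinearConstraint {x | f x = q} := by
  obtain ⟨L, c, h⟩ := hf
  refine ⟨fun i => L (fun j => if i = j then 1 else 0), q - c, .inr ?_⟩
  ext x
  have h1 := L.pi_apply_eq_sum_univ x
  simp only [smul_eq_mul] at h1
  show f x = q ↔ (∑ i, _ : ℝ) = _
  rw [h, h1, eq_sub_iff_add_eq]
  simp only [mul_comm]

end IsAffineFun

namespace MarriageInstance
variable {A B : Type*} (G : MarriageInstance A B)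

theorem isAffineFun_voteA (a : A) (b : B) : IsAffineFun fun x => G.voteA x a b := by
  unfold voteA
  exact (IsAffineFun.sum _ fun e => .ite _ (.eval e) (.const 0)).sub
    (IsAffineFun.sum _ fun e => .ite _ (.eval e) (.const 0))

theorem isAffineFun_voteB (b : B) (a : A) : IsAffineFun fun x => G.voteB x b a := by
  unfold voteB
  exact (IsAffineFun.sum _ fun e => .ite _ (.eval e) (.const 0)).sub
    (IsAffineFun.sum _ fun e => .ite _ (.eval e) (.const 0))

theorem card_edges_le_card_matchings : #G.edges ≤ #G.matchings := by
  refine card_le_card_of_injOn (fun e => {e}) (fun e he => ?_) fun e _ f _ h => by simpa using h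
  refine mem_filter.2 ⟨mem_powerset.2 (singleton_subset_iff.2 he), singleton_subset_iff.2 he, ?_, ?_⟩
  · intro e₁ h₁ e₂ h₂ _
    rw [mem_singleton.1 h₁, mem_singleton.1 h₂]
  · intro e₁ h₁ e₂ h₂ _
    rw [mem_singleton.1 h₁, mem_singleton.1 h₂]

variable [Fintype A] [Fintype B]

theorem isAffineFun_wt (M : Finset (A × B)) : IsAffineFun fun x => G.wt x M := by
  unfold wt
  refine (IsAffineFun.sum _ fun a => ?_).add (IsAffineFun.sum _ fun b => ?_)
  · unfold matchVoteA
    refine .ite _ (.const _) ?_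
    by_cases h : MatchedA M a
    · simpa only [h, dif_pos] using G.isAffineFun_voteA a _
    · simpa only [h, dif_neg, not_false_iff] using IsAffineFun.const _
  · unfold matchVoteB
    refine .ite _ (.const _) ?_
    by_cases h : MatchedB M b
    · simpa only [h, dif_pos] using G.isAffineFun_voteB b _
    · simpa only [h, dif_neg, not_false_iff] using IsAffineFun.const _

theorem isLinearConstraint_constraint (i : G.ConstraintIndex) :
    IsLinearConstraint (G.constraint i) := by
  rcases i with ⟨a, h⟩ | ⟨b, h⟩ | ⟨e, h⟩ | ⟨e, h⟩ | ⟨M, h⟩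
  · exact (IsAffineFun.sum _ fun e => .ite _ (.eval e) (.const 0)).isLinearConstraint_eq 1
  · exact (IsAffineFun.sum _ fun e => .ite _ (.eval e) (.const 0)).isLinearConstraint_eq 1
  · exact (IsAffineFun.eval e).isLinearConstraint_eq 0
  · have := ((IsAffineFun.const 0).sub (IsAffineFun.eval e)).isLinearConstraint_le 0
    simp only [zero_sub, neg_nonpos] at this
    exact this
  · exact (G.isAffineFun_wt M).isLinearConstraint_le _

theorem dominantPolytope_eq_iInter : G.dominantPolytope = ⋂ i, G.constraint i := by
  refine Set.Subset.antisymm (convexHull_min ?_ ?_) fun x hx =>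
    (isFeasible_of_mem hx).mem_dominantPolytope
  · rintro x ⟨M, hM, rfl⟩
    exact Set.mem_iInter.2 hM.incidence_mem_constraint
  · refine convex_iInter fun i => ?_
    obtain ⟨p, q, h | h⟩ := G.isLinearConstraint_constraint i
    · rw [h]
      exact convex_halfSpace_le (IsLinearMap.mk
        (fun x y => by simp [mul_add, sum_add_distrib])
        (fun c x => by simp [mul_sum, mul_left_comm])) q
    · rw [h]
      exact convex_hyperplane (IsLinearMap.mk
        (fun x y => by simp [mul_add, sum_add_distrib])
        (fun c x => by simp [mul_sum, mul_left_comm])) q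

variable {G} in
theorem exists_edge_of_not_unpopularA {a : A} (h : ¬ G.UnpopularA a) :
    ∃ e : G.edges, e.1.1 = a := by
  simp only [UnpopularA, not_forall, not_not] at h
  obtain ⟨M, hM, b, hb⟩ := h
  exact ⟨⟨(a, b), hM.1.1.1 hb⟩, rfl⟩

variable {G} in
theorem exists_edge_of_not_unpopularB {b : B} (h : ¬ G.UnpopularB b) :
    ∃ e : G.edges, e.1.2 = b := by
  simp only [UnpopularB, not_forall, not_not] at h
  obtain ⟨M, hM, a, ha⟩ := h
  exact ⟨⟨(a, b), hM.1.1.1 ha⟩, rfl⟩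

/-- Every constraint is charged to an edge or to a matching. -/
noncomputable def constraintCharge :
    G.ConstraintIndex → G.edges ⊕ G.edges ⊕ G.edges ⊕ G.matchings
  | .vertexA _ h => .inl (exists_edge_of_not_unpopularA h).choose
  | .vertexB _ h => .inr (.inl (exists_edge_of_not_unpopularB h).choose)
  | .zero e _ => .inr (.inr (.inl e))
  | .nonneg e _ => .inr (.inr (.inl e))
  | .matching M h => .inr (.inr (.inr ⟨M, mem_filter.2 ⟨mem_powerset.2 h.1, h⟩⟩))

theorem constraintCharge_injective : Function.Injective G.constraintCharge := by
  rintro (⟨a, h⟩ | ⟨b, h⟩ | ⟨e, h⟩ | ⟨e, h⟩ | ⟨M, h⟩)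
    (⟨a', h'⟩ | ⟨b', h'⟩ | ⟨e', h'⟩ | ⟨e', h'⟩ | ⟨M', h'⟩) heq <;>
    simp only [constraintCharge, Sum.inl.injEq, Sum.inr.injEq, reduceCtorEq]
      at heq
  · have : a = a' := by
      rw [← (exists_edge_of_not_unpopularA h).choose_spec, heq,
        (exists_edge_of_not_unpopularA h').choose_spec]
    subst this
    rfl
  · have : b = b' := by
      rw [← (exists_edge_of_not_unpopularB h).choose_spec, heq,
        (exists_edge_of_not_unpopularB h').choose_spec]
    subst this
    rfl
  · subst heq
    rfl
  · subst heq
    exact absurd h' h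
  · subst heq
    exact absurd h h'
  · subst heq
    rfl
  · have := congr_arg Subtype.val heq
    simp only at this
    subst this
    rfl

theorem finite_constraintIndex : Finite G.ConstraintIndex :=
  Finite.of_injective _ G.constraintCharge_injective

/-- Vertex constraints on each side are charged to incident edges, and an edge has only one of the
two entry constraints. This gives three copies of the edge set, each at most the number of matchings
since single edges are matchings. -/
theorem card_constraintIndex_le : Nat.card G.ConstraintIndex ≤ 4 * #G.matchings := by
  refine (Nat.card_le_card_of_injective _ G.constraintCharge_injective).trans ?_
  have := G.card_edges_le_card_matchings
  simp only [Nat.card_eq_fintype_card, Fintype.card_sum, Fintype.card_coe]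
  omega

end MarriageInstance
end

/-! ### A criterion for facets of a convex hull -/

section
open Classical Finset

section
variable {ι : Type*} [Fintype ι]

/-- A facet is recovered from its extreme points, a subset of `V`. Finiteness matters because
`Set.ncard` is zero on infinite sets. -/
theorem finite_setOf_isFacet_convexHull {V : Set (ι → ℝ)} (hV : V.Finite) :
    {F | IsFacet (convexHull ℝ V) F}.Finite := by
  have hc : IsCompact (convexHull ℝ V) := hV.isCompact_convexHull ℝ
  refine Set.Finite.of_finite_image (f := fun F => Set.extremePoints ℝ F)
    (hV.finite_subsets.subset ?_) ?_
  · rintro _ ⟨F, hF, rfl⟩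
    exact hF.2.1.isExtreme.extremePoints_subset_extremePoints.trans
      extremePoints_convexHull_subset
  · intro F hF F' hF' h
    have e : ∀ K, IsFacet (convexHull ℝ V) K →
        closure (convexHull ℝ (Set.extremePoints ℝ K)) = K := fun K hK =>
      closure_convexHull_extremePoints (hK.2.1.isCompact hc)
        (hK.2.1.convex (convex_convexHull ℝ V))
    rw [← e F hF, ← e F' hF']
    exact congr_arg _ (congr_arg _ h)

/-- A valid inequality whose tight vertices span, up to one dimension, defines a facet. -/
theorem isFacet_convexHull {V : Set (ι → ℝ)} (l : (ι → ℝ) →ₗ[ℝ] ℝ) (c : ℝ)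
    (hle : ∀ v ∈ V, l v ≤ c) {v₀ v₁ : ι → ℝ} (hv₀ : v₀ ∈ V) (h₀ : l v₀ = c) (hv₁ : v₁ ∈ V)
    (h₁ : l v₁ < c) (w : ι → ℝ)
    (hw : ∀ v ∈ V, v - v₁ ∈ vectorSpan ℝ {v ∈ V | l v = c} ⊔ Submodule.span ℝ {w}) :
    IsFacet (convexHull ℝ V) {x ∈ convexHull ℝ V | l x = c} := by
  set P := convexHull ℝ V with hP
  have hVP : V ⊆ P := subset_convexHull ℝ V
  have hleP : ∀ x ∈ P, l x ≤ c := fun x hx =>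
    convexHull_min hle (convex_halfSpace_le l.isLinear c) hx
  refine ⟨⟨v₀, hVP hv₀, h₀⟩, fun _ => ⟨LinearMap.toContinuousLinearMap l, ?_⟩, ?_⟩
  · ext x
    refine ⟨fun hx => ⟨hx.1, fun y hy => ?_⟩, fun hx => ⟨hx.1, le_antisymm (hleP x hx.1) ?_⟩⟩
    · simpa [hx.2] using hleP y hy
    · simpa [h₀] using hx.2 v₀ (hVP hv₀)
  · set F := {x ∈ P | l x = c} with hF
    have hFP : vectorSpan ℝ F ≤ vectorSpan ℝ P := vectorSpan_mono ℝ fun x hx => hx.1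
    have hker : vectorSpan ℝ F ≤ LinearMap.ker l := by
      rw [vectorSpan_def, Submodule.span_le]
      rintro _ ⟨x, hx, y, hy, rfl⟩
      simp [hx.2, hy.2]
    -- Strict because `l` is constant on `F` but not on `P`; one further direction `w` spans the
    -- rest, so the dimensions differ by exactly one.
    have hlt : vectorSpan ℝ F < vectorSpan ℝ P := by
      refine lt_of_le_of_ne hFP fun h => ?_
      have h2 : v₁ - v₀ ∈ vectorSpan ℝ F :=
        h ▸ vsub_mem_vectorSpan ℝ (hVP hv₁) (hVP hv₀)
      have h3 : l (v₁ - v₀) = 0 := hker h2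
      rw [map_sub, h₀] at h3
      linarith
    have hPV : vectorSpan ℝ P = vectorSpan ℝ V := by
      rw [← direction_affineSpan, ← direction_affineSpan, hP, affineSpan_convexHull]
    have hle' : vectorSpan ℝ P ≤ vectorSpan ℝ F ⊔ Submodule.span ℝ {w} := by
      rw [hPV, vectorSpan_eq_span_vsub_set_right ℝ hv₁, Submodule.span_le]
      rintro _ ⟨v, hv, rfl⟩
      have hsub : {v ∈ V | l v = c} ⊆ F := fun x hx => ⟨hVP hx.1, hx.2⟩
      exact sup_le_sup_right (vectorSpan_mono ℝ hsub) _ (hw v hv)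
    have h2 := Submodule.finrank_lt_finrank_of_lt hlt
    have h3 := Submodule.finrank_mono hle'
    have h4 := Submodule.finrank_add_le_finrank_add_finrank (vectorSpan ℝ F)
      (Submodule.span ℝ {w})
    have h5 : Module.finrank ℝ (Submodule.span ℝ {w}) ≤ 1 := by
      simpa using finrank_span_le_card (R := ℝ) ({w} : Set (ι → ℝ))
    omega
end

/-! ### The chain of 4-cycles and its dominant matchings -/

namespace CycleChain
open MarriageInstance

variable {n : ℕ}

/-- The position of a 4-cycle in the chain. -/
def level (c : Fin n × Bool) : ℕ := 2 * c.1 + c.2.toNat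

theorem level_injective : Function.Injective (level : Fin n × Bool → ℕ) := by
  rintro ⟨k, c⟩ ⟨k', c'⟩ h
  simp only [level] at h
  cases c <;> cases c' <;> simp only [Bool.toNat_false, Bool.toNat_true] at h
  · have : k = k' := Fin.ext (by omega)
    rw [this]
  · omega
  · omega
  · have : k = k' := Fin.ext (by omega)
    rw [this]

/-- A chain of 4-cycles. The two sides of cycle `c` are the vertices `(c, false)`, `(c, true)` of
`A` and of `B`; edges between consecutive cycles go up from `B` to `A`. -/
noncomputable def inst (n : ℕ) : MarriageInstance ((Fin n × Bool) × Bool) ((Fin n × Bool) × Bool) where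
  edges := univ.filter fun e => e.1.1 = e.2.1 ∨
    (level e.1.1 = level e.2.1 + 1 ∧ e.1.2 = e.2.2 ∧ (e.1.2 = true ∨ e.2.1.2 = false))
  -- Inside a cycle `A` favours the straight edges and `B` the crossing ones. A chain edge on the
  -- `true` side is best for `A` and worst for `B`, so its votes always cancel and it only makes
  -- potentials monotone. A chain edge on the `false` side ranks between the two cycle edges at both
  -- endpoints, so both favour it over their partners exactly at an ascent.
  rankA a b := if a.1 = b.1 then (if a.2 = b.2 then 1 else 3) else if a.2 then 0 else 2
  rankB b a := if a.1 = b.1 then (if a.2 = b.2 then 3 else 1) else if b.2 then 4 else 2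
  rankA_strict := by
    rintro ⟨c, s⟩ ⟨c₁, t₁⟩ ⟨c₂, t₂⟩ h₁ h₂ h
    simp only [mem_filter, mem_univ, true_and] at h₁ h₂
    by_cases e₁ : c = c₁ <;> by_cases e₂ : c = c₂
    · subst e₁ e₂
      cases s <;> cases t₁ <;> cases t₂ <;> simp_all
    · cases s <;> cases t₁ <;> cases t₂ <;> simp_all
    · cases s <;> cases t₁ <;> cases t₂ <;> simp_all
    · have h3 := h₁.resolve_left e₁
      have h4 := h₂.resolve_left e₂
      have : c₁ = c₂ := level_injective (by omega)
      rw [this, ← h3.2.1, ← h4.2.1]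
  rankB_strict := by
    rintro ⟨c, s⟩ ⟨c₁, t₁⟩ ⟨c₂, t₂⟩ h₁ h₂ h
    simp only [mem_filter, mem_univ, true_and] at h₁ h₂
    by_cases e₁ : c₁ = c <;> by_cases e₂ : c₂ = c
    · subst e₁ e₂
      cases s <;> cases t₁ <;> cases t₂ <;> simp_all
    · cases s <;> cases t₁ <;> cases t₂ <;> simp_all
    · cases s <;> cases t₁ <;> cases t₂ <;> simp_all
    · have h3 := h₁.resolve_left e₁
      have h4 := h₂.resolve_left e₂
      have : c₁ = c₂ := level_injective (by omega)
      rw [this, h3.2.1, h4.2.1]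

theorem mem_edges {a b : (Fin n × Bool) × Bool} : (a, b) ∈ (inst n).edges ↔ a.1 = b.1 ∨
    (level a.1 = level b.1 + 1 ∧ a.2 = b.2 ∧ (a.2 = true ∨ b.1.2 = false)) := by
  simp [inst]

/-- The matching inside the cycles that crosses exactly in the cycles of `T`. -/
noncomputable def crossing (T : Finset (Fin n × Bool)) :
    Finset (((Fin n × Bool) × Bool) × ((Fin n × Bool) × Bool)) :=
  univ.filter fun e => e.1.1 = e.2.1 ∧ e.2.2 = (e.1.2 ^^ decide (e.1.1 ∈ T))

theorem mem_crossing {T : Finset (Fin n × Bool)} {a b : (Fin n × Bool) × Bool} :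
    (a, b) ∈ crossing T ↔ a.1 = b.1 ∧ b.2 = (a.2 ^^ decide (a.1 ∈ T)) := by
  simp [crossing]

theorem isMatching_crossing (T : Finset (Fin n × Bool)) : (inst n).IsMatching (crossing T) := by
  refine ⟨?_, ?_, ?_⟩
  · rintro ⟨a, b⟩ h
    exact mem_edges.2 (.inl (mem_crossing.1 h).1)
  · rintro ⟨⟨c, s⟩, ⟨c₁, t₁⟩⟩ h₁ ⟨⟨c', s'⟩, ⟨c₂, t₂⟩⟩ h₂ h
    rw [mem_crossing] at h₁ h₂
    simp_all
  · rintro ⟨⟨c, s⟩, ⟨c₁, t₁⟩⟩ h₁ ⟨⟨c', s'⟩, ⟨c₂, t₂⟩⟩ h₂ h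
    rw [mem_crossing] at h₁ h₂
    obtain ⟨e₁, e₂⟩ := h₁
    obtain ⟨e₃, e₄⟩ := h₂
    simp only [Prod.mk.injEq] at e₁ e₂ e₃ e₄ h
    obtain ⟨rfl, rfl⟩ := h
    subst e₁ e₃
    have := e₂.symm.trans e₄
    rw [show s = s' by simpa using this]

theorem crossing_mem_left (T : Finset (Fin n × Bool)) (c : Fin n × Bool) (s : Bool) :
    ((c, s), (c, s ^^ decide (c ∈ T))) ∈ crossing T := mem_crossing.2 ⟨rfl, rfl⟩

theorem crossing_mem_right (T : Finset (Fin n × Bool)) (c : Fin n × Bool) (t : Bool) :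
    ((c, t ^^ decide (c ∈ T)), (c, t)) ∈ crossing T := mem_crossing.2 ⟨rfl, by simp⟩

theorem shiftVoteA_crossing (T : Finset (Fin n × Bool)) (c : Fin n × Bool) (s : Bool)
    (b : (Fin n × Bool) × Bool) :
    (inst n).shiftVoteA (crossing T) (c, s) b =
      (if (inst n).rankA (c, s) b < (if c ∈ T then 3 else 1) then 1 else 0) -
      (if (if c ∈ T then 3 else 1) < (inst n).rankA (c, s) b then 1 else 0) := by
  have hr : (inst n).rankA (c, s) (c, s ^^ decide (c ∈ T)) = if c ∈ T then 3 else 1 := by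
    by_cases h : c ∈ T <;> simp [inst, h]
  rw [shiftVoteA, shiftVote_of_mem (Q := fun b' => ((c, s), b') ∈ crossing T) _ _ (crossing_mem_left T c s)
    fun s' hs' => (isMatching_crossing T).eq_right hs' (crossing_mem_left T c s), hr]

theorem shiftVoteB_crossing (T : Finset (Fin n × Bool)) (c : Fin n × Bool) (t : Bool)
    (a : (Fin n × Bool) × Bool) :
    (inst n).shiftVoteB (crossing T) (c, t) a =
      (if (inst n).rankB (c, t) a < (if c ∈ T then 1 else 3) then 1 else 0) -
      (if (if c ∈ T then 1 else 3) < (inst n).rankB (c, t) a then 1 else 0) := by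
  have hr : (inst n).rankB (c, t) (c, t ^^ decide (c ∈ T)) = if c ∈ T then 1 else 3 := by
    by_cases h : c ∈ T <;> simp [inst, h]
  rw [shiftVoteB, shiftVote_of_mem (Q := fun a' => (a', (c, t)) ∈ crossing T) _ _ (crossing_mem_right T c t)
    fun s' hs' => (isMatching_crossing T).eq_left hs' (crossing_mem_right T c t), hr]

/-- The sum of the votes of the endpoints of an edge inside a cycle is zero. -/
theorem shiftVote_add_cycle (T : Finset (Fin n × Bool)) (c : Fin n × Bool) (s t : Bool) :
    (inst n).shiftVoteA (crossing T) (c, s) (c, t) +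
      (inst n).shiftVoteB (crossing T) (c, t) (c, s) = 0 := by
  rw [shiftVoteA_crossing, shiftVoteB_crossing]
  by_cases h : c ∈ T <;> by_cases hs : s = t <;> simp [inst, h, hs]

/-- The votes of the endpoints of an edge of the first kind between two cycles cancel. -/
theorem shiftVote_add_true (T : Finset (Fin n × Bool)) {c c' : Fin n × Bool} (hc : c ≠ c') :
    (inst n).shiftVoteA (crossing T) (c, true) (c', true) +
      (inst n).shiftVoteB (crossing T) (c', true) (c, true) = 0 := by
  rw [shiftVoteA_crossing, shiftVoteB_crossing]
  by_cases h : c ∈ T <;> by_cases h' : c' ∈ T <;> simp [inst, h, h', hc]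

theorem shiftVote_add_false (T : Finset (Fin n × Bool)) {c c' : Fin n × Bool} (hc : c ≠ c') :
    (inst n).shiftVoteA (crossing T) (c, false) (c', false) +
      (inst n).shiftVoteB (crossing T) (c', false) (c, false) =
      (if c ∈ T then 1 else -1) + if c' ∈ T then -1 else 1 := by
  rw [shiftVoteA_crossing, shiftVoteB_crossing]
  by_cases h : c ∈ T <;> by_cases h' : c' ∈ T <;> simp [inst, h, h', hc]

/-- In the pair of cycles with index `k`, only the upper cycle is crossed. -/
def IsAscent (T : Finset (Fin n × Bool)) (k : Fin n) : Prop := (k, false) ∉ T ∧ (k, true) ∈ T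

/-- At most one pair of cycles is an ascent. -/
def AtMostOneAscent (T : Finset (Fin n × Bool)) : Prop :=
  ∀ k k', IsAscent T k → IsAscent T k' → k = k'

/-- The certificate is a monotone potential, constant on cycles, whose single jump from -1 to 1 lies
inside the pair `k₀`, where a chain edge may have weight 2. -/
theorem isDominant_crossing_of_forall (T : Finset (Fin n × Bool)) (k₀ : Fin n)
    (hT : ∀ k, IsAscent T k → k = k₀) : (inst n).IsDominant (crossing T) := by
  let P : Fin n × Bool → ℝ := fun c => if level c ≤ 2 * k₀ then -1 else 1
  have hmA : ∀ a, MatchedA (crossing T) a := fun a => ⟨_, crossing_mem_left T a.1 a.2⟩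
  have hmB : ∀ b, MatchedB (crossing T) b := fun b => ⟨_, crossing_mem_right T b.1 b.2⟩
  refine isDominant_of_potential (isMatching_crossing T) (fun a => P a.1) (fun b => -P b.1)
    (fun a h => (h (hmA a)).elim) (fun a h => (h (hmB a)).elim) (fun a _ => ?_) (fun b _ => ?_)
    (fun a b h => ?_) ?_
  · simp only [P]
    split_ifs <;> norm_num
  · simp only [P]
    split_ifs <;> norm_num
  · rw [(mem_crossing.1 h).1]
    ring
  · rintro ⟨c, s⟩ ⟨c', t⟩ hab
    rw [mem_edges] at hab
    simp only at hab ⊢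
    rcases hab with rfl | ⟨hl, rfl, h⟩
    · rw [shiftVote_add_cycle]
      linarith
    · have hne : c ≠ c' := by
        rintro rfl
        omega
      have hmono : P c' ≤ P c := by
        simp only [P]
        split_ifs
        · exact le_rfl
        · norm_num
        · omega
        · exact le_rfl
      rcases s with _ | _
      · rw [shiftVote_add_false T hne]
        obtain ⟨k, i⟩ := c
        obtain ⟨k', i'⟩ := c'
        have hi' : i' = false := by simpa using h
        subst hi'
        simp only [level, Bool.toNat_false] at hl
        have hi : i = true := by
          cases i
          · simp only [Bool.toNat_false] at hl
            omega
          · rfl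
        subst hi
        simp only [Bool.toNat_true] at hl
        have hk : k = k' := Fin.ext (by omega)
        subst hk
        by_cases h1 : (k, true) ∈ T <;> by_cases h2 : (k, false) ∈ T
        · simp only [h1, h2, if_true]
          linarith
        · have := hT k ⟨h2, h1⟩
          subst this
          simp only [h1, h2, if_true, if_false, P, level, Bool.toNat_false, Bool.toNat_true]
          simp
        · simp only [h1, h2, if_true, if_false]
          linarith
        · simp only [h1, h2, if_false]
          linarith
      · rw [shiftVote_add_true T hne]
        linarith

theorem isDominant_crossing (T : Finset (Fin (n + 1) × Bool)) (hT : AtMostOneAscent T) :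
    (inst (n + 1)).IsDominant (crossing T) := by
  by_cases h : ∃ k, IsAscent T k
  · obtain ⟨k, hk⟩ := h
    exact isDominant_crossing_of_forall T k fun k' hk' => hT k' k hk' hk
  · exact isDominant_crossing_of_forall T 0 fun k hk => (h ⟨k, hk⟩).elim

/-- A dual certificate is constant on each cycle, monotone along the chain and confined to `[-1,
1]`. Each ascent forces an increase of at least 2, so there is room for only one. -/
theorem atMostOneAscent_of_isDominant {T : Finset (Fin n × Bool)}
    (hD : (inst n).IsDominant (crossing T)) : AtMostOneAscent T := by
  have hmA : ∀ a, MatchedA (crossing T) a := fun a => ⟨_, crossing_mem_left T a.1 a.2⟩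
  have hmB : ∀ b, MatchedB (crossing T) b := fun b => ⟨_, crossing_mem_right T b.1 b.2⟩
  have hM := isMatching_crossing T
  obtain ⟨α, β, hcov, hα, hβ, hsum⟩ := exists_dual_of_matching_weights (inst n).edges
    (fun a b => (inst n).shiftVoteA (crossing T) a b + (inst n).shiftVoteB (crossing T) b a)
    (fun _ => -1) (fun _ => -1) fun N h1 h2 h3 => by
      have h4 := votes_sub_votes_add_eq (M := crossing T) (N := N) ⟨h1, h2, h3⟩
      have h5 : ((inst n).votes N (crossing T) : ℝ) + numNewlyMatched N (crossing T) ≤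
          (inst n).votes (crossing T) N := by
        exact_mod_cast hD.votes_add_numNewlyMatched_le ⟨h1, h2, h3⟩
      simp only [hmA, hmB, if_true] at h4
      linarith
  have hM0 : ∀ e ∈ crossing T, 0 ≤ α e.1 + β e.2 := by
    rintro ⟨⟨c, s⟩, ⟨c', t⟩⟩ he
    obtain rfl : c = c' := (mem_crossing.1 he).1
    have := hcov _ _ (hM.1 he)
    rwa [shiftVote_add_cycle] at this
  have htight : ∀ e ∈ crossing T, α e.1 + β e.2 = 0 := by
    rw [sum_eq_sum_fst_add _ hM.2.1 α, sum_eq_sum_snd_add _ hM.2.2 β] at hsum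
    simp only [hmA, hmB, if_true, sum_const_zero, add_zero] at hsum
    rw [← sum_add_distrib] at hsum
    exact (sum_eq_zero_iff_of_nonneg hM0).1 (le_antisymm hsum (sum_nonneg hM0))
  have hβα : ∀ c t, β (c, t) = -α (c, t ^^ decide (c ∈ T)) := fun c t => by
    have := htight _ (crossing_mem_right T c t)
    simp only at this
    linarith
  have hle : ∀ c s s', α (c, s') ≤ α (c, s) := by
    intro c s s'
    have h1 := hcov (c, s) (c, s' ^^ decide (c ∈ T)) (mem_edges.2 (.inl rfl))
    rw [shiftVote_add_cycle, hβα, Bool.xor_assoc, Bool.xor_self, Bool.xor_false] at h1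
    linarith
  let p : Fin n × Bool → ℝ := fun c => α (c, false)
  have hp : ∀ c s, α (c, s) = p c := fun c s => le_antisymm (hle _ _ _) (hle _ _ _)
  have hpβ : ∀ c t, β (c, t) = -p c := fun c t => by rw [hβα, hp]
  have hp1 : ∀ c, -1 ≤ p c := fun c => hα _
  have hp2 : ∀ c, p c ≤ 1 := fun c => by
    have := hβ (c, false)
    rw [hpβ] at this
    linarith
  have hstep : ∀ c c', level c = level c' + 1 → p c' ≤ p c := by
    intro c c' h
    have hne : c ≠ c' := by
      rintro rfl
      omega
    have h1 := hcov (c, true) (c', true) (mem_edges.2 (.inr ⟨h, rfl, .inl rfl⟩))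
    rw [shiftVote_add_true T hne, hp, hpβ] at h1
    linarith
  have hmono : ∀ (d : ℕ) (c c' : Fin n × Bool), level c = level c' + d → p c' ≤ p c := by
    intro d
    induction d with
    | zero =>
      intro c c' h
      rw [level_injective h]
    | succ d ih =>
      rintro c ⟨k, i⟩ h
      have hc : level c < 2 * n := by
        have := c.1.2
        have := c.2.toNat_le
        simp only [level]
        omega
      obtain ⟨c'', hc''⟩ : ∃ c'' : Fin n × Bool, level c'' = level (k, i) + 1 := by
        cases i
        · exact ⟨(k, true), by simp [level]⟩
        · simp only [level, Bool.toNat_true] at h hc ⊢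
          exact ⟨(⟨k + 1, by omega⟩, false), by simp; omega⟩
      exact (hstep c'' _ hc'').trans (ih c c'' (by omega))
  have hasc : ∀ k, IsAscent T k → p (k, false) + 2 ≤ p (k, true) := by
    intro k hk
    have h1 := hcov ((k, true), false) ((k, false), false)
      (mem_edges.2 (.inr ⟨by simp [level], rfl, .inr rfl⟩))
    rw [shiftVote_add_false T (by simp), hp, hpβ, if_pos hk.2, if_neg hk.1] at h1
    linarith
  have hlt : ∀ k k', IsAscent T k → IsAscent T k' → ¬ k < k' := by
    intro k k' hk hk' hlt
    have h1 := hasc k hk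
    have h2 := hasc k' hk'
    have h3 := hmono (level (k', false) - level (k, true)) (k', false) (k, true) (by
      simp only [level, Bool.toNat_true, Bool.toNat_false]
      omega)
    have h4 := hp1 (k, false)
    have h5 := hp2 (k', true)
    linarith
  intro k k' hk hk'
  exact le_antisymm (not_lt.1 (hlt k' k hk' hk)) (not_lt.1 (hlt k k' hk hk'))

/-- The straight matching is dominant and perfect, so no vertex is unpopular and `M` is perfect.
Chain edges go strictly up from `B` to `A`, while the levels have the same total on both sides;
hence `M` contains no chain edge. -/
theorem exists_eq_crossing {M : Finset (((Fin (n + 1) × Bool) × Bool) × ((Fin (n + 1) × Bool) × Bool))}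
    (hD : (inst (n + 1)).IsDominant M) : ∃ T, M = crossing T := by
  have hM := hD.1.1
  have h0 := isDominant_crossing (∅ : Finset (Fin (n + 1) × Bool)) fun k _ hk => by
    simp [IsAscent] at hk
  have hmA : ∀ a, MatchedA M a := fun a => by
    by_contra h
    exact (h0.unpopularA_iff a).1 ((hD.unpopularA_iff a).2 h) ⟨_, crossing_mem_left ∅ a.1 a.2⟩
  have hmB : ∀ b, MatchedB M b := fun b => by
    by_contra h
    exact (h0.unpopularB_iff b).1 ((hD.unpopularB_iff b).2 h) ⟨_, crossing_mem_right ∅ b.1 b.2⟩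
  have hlevel : ∀ e ∈ M, level e.2.1 = level e.1.1 := by
    refine (sum_eq_sum_iff_of_le ?_).1 ?_
    · rintro ⟨a, b⟩ he
      rcases mem_edges.1 (hM.1 he) with h | h
      · simp only
        rw [h]
      · simp only
        omega
    · have h1 := sum_eq_sum_fst_add M hM.2.1 fun a => level a.1
      have h2 := sum_eq_sum_snd_add M hM.2.2 fun b => level b.1
      simp only [hmA, hmB, if_true, sum_const_zero, add_zero] at h1 h2
      rw [← h1, ← h2]
  have hcyc : ∀ c s, ∃ t, ((c, s), (c, t)) ∈ M := by
    intro c s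
    obtain ⟨⟨c', t⟩, h⟩ := hmA (c, s)
    obtain rfl : c' = c := level_injective (hlevel _ h)
    exact ⟨t, h⟩
  let T : Finset (Fin (n + 1) × Bool) := univ.filter fun c => ((c, false), (c, true)) ∈ M
  have hT : ∀ c s, ((c, s), (c, s ^^ decide (c ∈ T))) ∈ M := by
    intro c s
    obtain ⟨t₀, h₀⟩ := hcyc c false
    obtain ⟨t₁, h₁⟩ := hcyc c true
    have hne : t₀ ≠ t₁ := by
      rintro rfl
      have := hM.eq_left h₀ h₁
      simp at this
    have hcT : c ∈ T ↔ t₀ = true := by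
      simp only [T, mem_filter, mem_univ, true_and]
      refine ⟨fun h => ?_, fun h => h ▸ h₀⟩
      have := hM.eq_right h₀ h
      simpa using this
    cases t₀ <;> cases t₁ <;> cases s <;> simp_all
  refine ⟨T, ?_⟩
  ext ⟨⟨c, s⟩, b⟩
  refine ⟨fun h => ?_, fun h => ?_⟩
  · rw [hM.eq_right h (hT c s)]
    exact crossing_mem_left T c s
  · rw [(isMatching_crossing T).eq_right h (crossing_mem_left T c s)]
    exact hT c s

theorem dominantPolytope_inst : (inst (n + 1)).dominantPolytope =
    convexHull ℝ {x | ∃ T, AtMostOneAscent T ∧ x = (inst (n + 1)).incidence (crossing T)} := by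
  rw [dominantPolytope]
  congr 1
  ext x
  constructor
  · rintro ⟨M, hM, rfl⟩
    obtain ⟨T, rfl⟩ := exists_eq_crossing hM
    exact ⟨T, atMostOneAscent_of_isDominant hM, rfl⟩
  · rintro ⟨T, hT, rfl⟩
    exact ⟨_, isDominant_crossing T hT, rfl⟩

end CycleChain
end

/-! ### Exponentially many facets -/

section
open Classical Finset

namespace CycleChain
open MarriageInstance

variable {n : ℕ}

/-- The change of the incidence vector when the cycle `c` becomes crossing. -/
noncomputable def rotation (c : Fin n × Bool) : (inst n).edges → ℝ := fun e =>
  if e.1.1.1 = c ∧ e.1.2.1 = c then (if e.1.1.2 = e.1.2.2 then -1 else 1) else 0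

theorem incidence_crossing (T : Finset (Fin n × Bool)) :
    (inst n).incidence (crossing T) = (inst n).incidence (crossing ∅) + ∑ c ∈ T, rotation c := by
  funext e
  rw [Pi.add_apply, Finset.sum_apply]
  obtain ⟨⟨⟨c, s⟩, ⟨c', t⟩⟩, he⟩ := e
  simp only [incidence, mem_crossing, rotation]
  by_cases h : c = c'
  · subst h
    have h1 : ∀ x : Fin n × Bool, (c = x ∧ c = x) ↔ x = c := fun x => by
      rw [and_self, eq_comm]
    simp only [h1, sum_ite_eq']
    by_cases hT : c ∈ T <;> cases s <;> cases t <;> simp [hT]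
  · rw [sum_eq_zero]
    · simp [h]
    · intro x _
      rw [if_neg]
      rintro ⟨h1, h2⟩
      exact h (h1.trans h2.symm)

/-- The edge that is in a matching inside the cycles if and only if the cycle `c` is crossing. -/
noncomputable def crossEdge (c : Fin n × Bool) : (inst n).edges :=
  ⟨((c, false), (c, true)), mem_edges.2 (.inl rfl)⟩

theorem rotation_crossEdge (c c' : Fin n × Bool) :
    rotation c (crossEdge c') = if c = c' then 1 else 0 := by
  simp [rotation, crossEdge, eq_comm]

theorem incidence_empty_crossEdge (c : Fin n × Bool) :
    (inst n).incidence (crossing ∅) (crossEdge c) = 0 := by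
  simp [incidence, crossEdge, mem_crossing]

/-- The weighted number of ascents in `S`. -/
noncomputable def ascentFunctional (S : Finset (Fin n)) : ((inst n).edges → ℝ) →ₗ[ℝ] ℝ :=
  ∑ k ∈ S, (LinearMap.proj (R := ℝ) (φ := fun _ => ℝ) (crossEdge (k, true)) -
    LinearMap.proj (crossEdge (k, false)))

theorem ascentFunctional_rotation_true (S : Finset (Fin n)) (k : Fin n) :
    ascentFunctional S (rotation (k, true)) = if k ∈ S then 1 else 0 := by
  simp [ascentFunctional, LinearMap.sum_apply, rotation_crossEdge]

theorem ascentFunctional_rotation_false (S : Finset (Fin n)) (k : Fin n) :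
    ascentFunctional S (rotation (k, false)) = if k ∈ S then -1 else 0 := by
  simp [ascentFunctional, LinearMap.sum_apply, rotation_crossEdge]
  split_ifs <;> simp

theorem ascentFunctional_incidence_empty (S : Finset (Fin n)) :
    ascentFunctional S ((inst n).incidence (crossing ∅)) = 0 := by
  simp [ascentFunctional, LinearMap.sum_apply, incidence_empty_crossEdge]

theorem incidence_crossing_crossEdge (T : Finset (Fin n × Bool)) (c : Fin n × Bool) :
    (inst n).incidence (crossing T) (crossEdge c) = if c ∈ T then 1 else 0 := by
  simp [incidence, crossEdge, mem_crossing]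

theorem ascentFunctional_incidence_le (S : Finset (Fin n)) {T : Finset (Fin n × Bool)}
    (hT : AtMostOneAscent T) : ascentFunctional S ((inst n).incidence (crossing T)) ≤ 1 := by
  have h1 : ascentFunctional S ((inst n).incidence (crossing T)) ≤
      ∑ k ∈ S, if IsAscent T k then (1 : ℝ) else 0 := by
    simp only [ascentFunctional, LinearMap.sum_apply, LinearMap.sub_apply, LinearMap.proj_apply,
      incidence_crossing_crossEdge]
    refine sum_le_sum fun k _ => ?_
    by_cases h1 : (k, true) ∈ T <;> by_cases h2 : (k, false) ∈ T <;> simp [IsAscent, h1, h2]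
  refine h1.trans ?_
  rw [sum_boole]
  have : #{k ∈ S | IsAscent T k} ≤ 1 :=
    card_le_one.2 fun a ha b hb => hT a b (mem_filter.1 ha).2 (mem_filter.1 hb).2
  exact_mod_cast this

/-- The vertices of the dominant matching polytope. -/
def vertexSet (n : ℕ) : Set ((inst n).edges → ℝ) :=
  {x | ∃ T, AtMostOneAscent T ∧ x = (inst n).incidence (crossing T)}

theorem finite_vertexSet : (vertexSet n).Finite := by
  refine (Set.finite_range fun T => (inst n).incidence (crossing T)).subset ?_
  rintro x ⟨T, -, rfl⟩
  exact ⟨T, rfl⟩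

/-- The face on which the ascent inequality of `S` is tight. -/
def ascentFace (S : Finset (Fin n)) : Set ((inst n).edges → ℝ) :=
  {x ∈ convexHull ℝ (vertexSet n) | ascentFunctional S x = 1}

/-- The incidence vector of the matching whose only crossing cycle is `(k, true)`. -/
noncomputable def ascentVertex (k : Fin n) : (inst n).edges → ℝ :=
  (inst n).incidence (crossing ∅) + rotation (k, true)

theorem ascentVertex_mem (k : Fin n) : ascentVertex k ∈ vertexSet n := by
  refine ⟨{(k, true)}, fun k₁ k₂ h₁ h₂ => ?_, ?_⟩
  · have e₁ := h₁.2
    have e₂ := h₂.2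
    simp only [mem_singleton, Prod.mk.injEq, and_true] at e₁ e₂
    rw [e₁, e₂]
  · rw [incidence_crossing, sum_singleton]
    rfl

theorem ascentVertex_add_pair_mem {k k' : Fin n} (h : k' ≠ k) :
    ascentVertex k + rotation (k', true) + rotation (k', false) ∈ vertexSet n := by
  refine ⟨{(k', false), (k', true), (k, true)}, fun k₁ k₂ h₁ h₂ => ?_, ?_⟩
  · simp only [IsAscent, mem_insert, mem_singleton, Prod.mk.injEq, and_true, and_false, or_false,
      false_or, reduceCtorEq] at h₁ h₂
    rw [h₁.2.resolve_left h₁.1, h₂.2.resolve_left h₂.1]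
  · rw [incidence_crossing, sum_insert (by simp), sum_insert (by simp [h]), sum_singleton,
      ascentVertex]
    abel

theorem ascentVertex_add_lower_mem (k k' : Fin n) :
    ascentVertex k + rotation (k', false) ∈ vertexSet n := by
  refine ⟨{(k', false), (k, true)}, fun k₁ k₂ h₁ h₂ => ?_, ?_⟩
  · simp only [IsAscent, mem_insert, mem_singleton, Prod.mk.injEq, and_true, and_false, or_false,
      false_or, reduceCtorEq] at h₁ h₂
    rw [h₁.2, h₂.2]
  · rw [incidence_crossing, sum_insert (by simp), sum_singleton, ascentVertex]
    abel

theorem ascentFunctional_ascentVertex (S : Finset (Fin n)) (k : Fin n) :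
    ascentFunctional S (ascentVertex k) = if k ∈ S then 1 else 0 := by
  rw [ascentVertex, map_add, ascentFunctional_incidence_empty, ascentFunctional_rotation_true,
    zero_add]

/-- Moving between tight vertices changes a whole pair of cycles, an upper cycle in `S` against
another one, or a lower cycle outside `S`. Together with the single rotation `(i, true)` these moves
generate all rotations, hence all differences of vertices. -/
theorem isFacet_ascentFace {S : Finset (Fin n)} {i j : Fin n} (hi : i ∈ S) (hj : j ∈ S)
    (hij : i ≠ j) : IsFacet (convexHull ℝ (vertexSet n)) (ascentFace S) := by
  have hempty : (inst n).incidence (crossing ∅) ∈ vertexSet n :=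
    ⟨∅, fun k _ hk => by simp [IsAscent] at hk, rfl⟩
  refine isFacet_convexHull (ascentFunctional S) 1 ?_ (ascentVertex_mem i)
    (by rw [ascentFunctional_ascentVertex, if_pos hi]) hempty
    (by rw [ascentFunctional_incidence_empty]; exact one_pos) (rotation (i, true)) ?_
  · rintro v ⟨T, hT, rfl⟩
    exact ascentFunctional_incidence_le S hT
  set F : Set ((inst n).edges → ℝ) := {v ∈ vertexSet n | ascentFunctional S v = 1} with hF
  set W := vectorSpan ℝ F ⊔ Submodule.span ℝ {rotation (i, true)} with hW
  have hsub : ∀ x ∈ F, ∀ y ∈ F, x - y ∈ W := fun x hx y hy =>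
    (le_sup_left : vectorSpan ℝ F ≤ W) (vsub_mem_vectorSpan ℝ hx hy)
  have hi_mem : rotation (i, true) ∈ W :=
    (le_sup_right : _ ≤ W) (Submodule.mem_span_singleton_self _)
  have hvert : ∀ k ∈ S, ascentVertex k ∈ F := fun k hk =>
    ⟨ascentVertex_mem k, by rw [ascentFunctional_ascentVertex, if_pos hk]⟩
  have hpair : ∀ k, rotation (k, true) + rotation (k, false) ∈ W := by
    intro k
    -- Two elements of `S` are needed here: the pair `k` is switched while the ascent stays at
    -- another element of `S`, so the inequality remains tight.
    obtain ⟨k₀, hk₀, hne⟩ : ∃ k₀ ∈ S, k ≠ k₀ := by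
      by_cases h : k = i
      · exact ⟨j, hj, h ▸ hij⟩
      · exact ⟨i, hi, h⟩
    have h1 : ascentVertex k₀ + rotation (k, true) + rotation (k, false) ∈ F := by
      refine ⟨ascentVertex_add_pair_mem hne, ?_⟩
      rw [map_add, map_add, ascentFunctional_ascentVertex, ascentFunctional_rotation_true,
        ascentFunctional_rotation_false, if_pos hk₀]
      split_ifs <;> norm_num
    have h2 := hsub _ h1 _ (hvert k₀ hk₀)
    rwa [add_assoc, add_sub_cancel_left] at h2
  have htrue : ∀ k, rotation (k, true) ∈ W := by
    intro k
    by_cases hk : k ∈ S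
    · have h2 := hsub _ (hvert k hk) _ (hvert i hi)
      rw [ascentVertex, ascentVertex, add_sub_add_left_eq_sub] at h2
      simpa using W.add_mem h2 hi_mem
    · have hne : k ≠ i := fun h => hk (h ▸ hi)
      have h1 : ascentVertex i + rotation (k, false) ∈ F := by
        refine ⟨ascentVertex_add_lower_mem i k, ?_⟩
        rw [map_add, ascentFunctional_ascentVertex, ascentFunctional_rotation_false, if_pos hi,
          if_neg hk, add_zero]
      have h2 := hsub _ h1 _ (hvert i hi)
      rw [add_sub_cancel_left] at h2
      simpa using W.sub_mem (hpair k) h2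
  have hrot : ∀ c : Fin n × Bool, rotation c ∈ W := by
    rintro ⟨k, _ | _⟩
    · simpa using W.sub_mem (hpair k) (htrue k)
    · exact htrue k
  rintro v ⟨T, -, rfl⟩
  rw [incidence_crossing, add_sub_cancel_left]
  exact W.sum_mem fun c _ => hrot c

theorem ascentFace_injective : Function.Injective (ascentFace : Finset (Fin n) → _) := by
  have h : ∀ (S : Finset (Fin n)) k, k ∈ S ↔ ascentVertex k ∈ ascentFace S := by
    intro S k
    have h1 : ascentVertex k ∈ ascentFace S ↔ ascentFunctional S (ascentVertex k) = 1 :=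
      ⟨fun h => h.2, fun h => ⟨subset_convexHull ℝ _ (ascentVertex_mem k), h⟩⟩
    rw [h1, ascentFunctional_ascentVertex]
    split_ifs with h <;> simp [h]
  intro S S' hS
  ext k
  rw [h, h, hS]

/-- Only the sets containing 0 and 1 are counted; this secures the two required elements and still
leaves `n` free choices. -/
theorem two_pow_le_numFacets (n : ℕ) : 2 ^ n ≤ numFacets (inst (n + 2)).dominantPolytope := by
  have h1 : #(Finset.Icc ({0, 1} : Finset (Fin (n + 2))) univ) = 2 ^ n := by
    rw [card_Icc_finset (subset_univ _), card_univ, Fintype.card_fin, card_pair (by simp)]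
    rfl
  rw [← h1, ← card_image_of_injective _ ascentFace_injective, ← Set.ncard_coe_finset, numFacets,
    dominantPolytope_inst]
  refine Set.ncard_le_ncard ?_ (finite_setOf_isFacet_convexHull finite_vertexSet)
  intro F hF
  obtain ⟨S, hS, rfl⟩ := mem_image.1 (mem_coe.1 hF)
  have h2 := (Finset.mem_Icc.1 hS).1
  exact isFacet_ascentFace (i := 0) (j := 1) (h2 (by simp)) (h2 (by simp)) (by simp)

theorem card_edges_le (n : ℕ) : #(inst n).edges ≤ 16 * n := by
  have h := card_le_card_of_injOn (s := (inst n).edges)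
    (t := (univ : Finset (((Fin n × Bool) × Bool) × Bool × Bool)))
    -- An edge is determined by its endpoint in `A`, whether it stays in the cycle, and the side of
    -- its endpoint in `B`, since a chain edge can only go one level down from `A`. This gives `4n ·
    -- 2 · 2` codes.
    (fun e => (e.1, decide (e.1.1 = e.2.1), e.2.2)) (fun _ _ => mem_coe.2 (mem_univ _)) (by
      rintro ⟨a, b⟩ he ⟨a', b'⟩ hf hef
      simp only [Prod.mk.injEq, decide_eq_decide] at hef
      obtain ⟨rfl, h1, h2⟩ := hef
      have he' := mem_edges.1 he
      have hf' := mem_edges.1 hf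
      have : b.1 = b'.1 := by
        by_cases h3 : a.1 = b.1
        · rw [← h3, h1.1 h3]
        · have h4 := he'.resolve_left h3
          have h5 := hf'.resolve_left (mt h1.2 h3)
          exact level_injective (by omega)
      rw [Prod.ext this h2])
  refine h.trans (le_of_eq ?_)
  simp only [card_univ, Fintype.card_prod, Fintype.card_fin, Fintype.card_bool]
  ring

theorem le_card_edges (n : ℕ) : n ≤ #(inst n).edges := by
  have h := card_le_card_of_injOn (s := (univ : Finset (Fin n))) (t := (inst n).edges)
    (fun k => (((k, false), false), ((k, false), false)))
    (fun k _ => mem_edges.2 (.inl rfl)) (fun k _ k' _ h => by simpa using h)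
  simpa using h

end CycleChain
end

theorem theorem4 :
    (∃ C : ℕ, ∀ (A : Type*) (B : Type*) [Fintype A] [Fintype B] (G : MarriageInstance A B),
      (∀ i : G.ConstraintIndex, IsLinearConstraint (G.constraint i)) ∧
      G.dominantPolytope = ⋂ i : G.ConstraintIndex, G.constraint i ∧
      Finite G.ConstraintIndex ∧
      Nat.card G.ConstraintIndex ≤ C * G.matchings.card) ∧
    (∃ c : ℝ, 1 < c ∧ ∃ δ : ℝ, 0 < δ ∧ ∀ m₀ : ℕ,
      ∃ (A : Type) (B : Type) (_ : Fintype A) (_ : Fintype B) (G : MarriageInstance A B),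
        m₀ ≤ G.edges.card ∧
        δ * c ^ G.edges.card ≤ (numFacets G.dominantPolytope : ℝ)) := by
  refine ⟨⟨4, fun A B _ _ G => ⟨G.isLinearConstraint_constraint, G.dominantPolytope_eq_iInter,
    G.finite_constraintIndex, G.card_constraintIndex_le⟩⟩, ?_⟩
  have hc : (1 : ℝ) < 2 ^ (1 / 16 : ℝ) := Real.one_lt_rpow (by norm_num) (by norm_num)
  have hc16 : ((2 : ℝ) ^ (1 / 16 : ℝ)) ^ 16 = 2 := by
    rw [← Real.rpow_natCast, ← Real.rpow_mul (by norm_num)]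
    norm_num
  -- With `n` pairs there are at most `16 n` edges and at least `2 ^ (n - 2)` facets. The base is
  -- therefore the 16th root of 2, and the factor 1/4 absorbs the two forced elements of `S`.
  refine ⟨_, hc, 1 / 4, by norm_num, fun m₀ => ⟨_, _, inferInstance, inferInstance,
    CycleChain.inst (m₀ + 2), ?_, ?_⟩⟩
  · exact (Nat.le_add_right m₀ 2).trans (CycleChain.le_card_edges _)
  · have h1 : ((2 : ℝ) ^ (1 / 16 : ℝ)) ^ (CycleChain.inst (m₀ + 2)).edges.card ≤ 2 ^ (m₀ + 2) := by
      refine (pow_le_pow_right₀ hc.le (CycleChain.card_edges_le _)).trans ?_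
      rw [pow_mul, hc16]
    have h2 : ((2 : ℝ) ^ m₀) ≤ numFacets (CycleChain.inst (m₀ + 2)).dominantPolytope := by
      exact_mod_cast CycleChain.two_pow_le_numFacets m₀
    rw [pow_add] at h1
    linarith
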